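/- Let $p(n)$ be the number of partitions of $n$ and, for $m\ge 1$, let $(q^m)_\infty=\prod_{k\ge1}(1-q^{mk})$, all as formal power series over $\mathbb Z$. Write $(q)_\infty=\sum_{n\ge0}b_nq^n$ and put $$J_1=\frac{1}{(q^7)_\infty}\sum_{n\ge0}b_{7n}q^n,\qquad J_2=\frac{1}{(q^7)_\infty}\sum_{n\ge0}b_{7n+1}q^n,\qquad J_3=\frac{1}{(q^7)_\infty}\sum_{n\ge0}b_{7n+5}q^n .$$ Then $$\frac{(q^{1/7})_\infty}{(q^7)_\infty}=J_1+q^{1/7}J_2-q^{2/7}+q^{5/7}J_3 .$$ Define \begin{align*} H_1&=2J_1^2J_2^8+2J_1^3J_2^6-J_1^4J_2^4-13J_1^5J_2^2+11J_1^6,\\ H_2&=5J_1^2J_2^7-9J_1^3J_2^5+15J_1^4J_2^3-15J_1^5J_2-3J_1^7J_3,\\ H_3&=11J_1^2J_2^6-31J_1^3J_2^4+26J_1^4J_2^2-5J_1^5+J_1^8J_3^2,\\ H_4&=J_1J_2^7+8J_1^2J_2^5-18J_1^3J_2^3+11J_1^4J_2+5J_1^6J_3,\\ H_5&=3J_1J_2^6+3J_1^2J_2^4-12J_1^3J_2^2+12J_1^4-J_1^7J_3^2,\\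 H_6&=7J_1J_2^5-7J_1^2J_2^3-14J_1^3J_2-7J_1^5J_3,\\ H_7&=J_2^6+J_1J_2^4+17J_1^2J_2^2-10J_1^3+2J_1^6J_3^2 . \end{align*} (i) For each $a=0,1,\dots,6$, $$\sum_{k\ge0}p(7k+a)q^k=\frac{(q^7)_\infty^7}{(q)_\infty^8}\,H_{1+a}(q).$$ (ii) Write $(q)_\infty^8=\sum_{n\ge0}D_nq^n$ and, for each $a=0,\dots,6$, $(q^7)_\infty^7H_{1+a}(q)=\sum_{n\ge0}Z_n^{(a)}q^n$. For all $k\ge0$ and all $a=0,\dots,6$, $p(7k+a)$ is the determinant of the $(k+1)\times(k+1)$ matrix $(M_{ij})_{0\le i,j\le k}$ with last column $M_{ik}=Z_i^{(a)}$ and, for $j<k$, $M_{ij}=D_{i-j}$ if $i\ge j$ and $M_{ij}=0$ if $i<j$. Moreover $(D_0,\dots,D_7)=(1,-8,20,0,-70,64,56,0)$. (iii) For $a=5$, $H_6=7\,\dfrac{(q)_\infty^4}{(q^7)_\infty^4}+49q$. Hence $$\sum_{k\ge0}p(7k+5)q^k=\frac{(q^7)_\infty^7}{(q)_\infty^8}\left[7\,\frac{(q)_\infty^4}{(q^7)_\infty^4}+49q\right],$$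 and, for all $k\ge0$, $p(7k+5)$ is the determinant in (ii) with $\sum_n Z_n^{(5)}q^n=7(q^7)_\infty^3(q)_\infty^4+49q(q^7)_\infty^7$, whose first eight coefficients are $7,21,14,56,-35,-28,-70,35$. -/

import Mathlib

open PowerSeries

/-- `(q^m)_∞ = ∏_{k ≥ 1} (1 - q^{mk})` as a formal power series over `ℤ` (the infinite product
converges coefficientwise for `m ≥ 1`, see `multipliable_qInf`). -/
noncomputable def qInf (m : ℕ) : ℤ⟦X⟧ :=
  open scoped PowerSeries.WithPiTopology in
  ∏' k : ℕ, (1 - (X : ℤ⟦X⟧) ^ (m * (k + 1)))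

open scoped PowerSeries.WithPiTopology in
theorem multipliable_qInf {m : ℕ} (hm : m ≠ 0) :
    Multipliable fun k : ℕ => 1 - (X : ℤ⟦X⟧) ^ (m * (k + 1)) := by
  simp_rw [sub_eq_add_neg]
  apply PowerSeries.WithPiTopology.multipliable_one_add_of_tendsto_order_atTop_nhds_top
  refine ENat.tendsto_nhds_top_iff_natCast_lt.mpr fun n =>
    Filter.eventually_atTop.mpr ⟨n, fun k hk => ?_⟩
  rw [order_neg, order_X_pow]
  have h : k + 1 ≤ m * (k + 1) := Nat.le_mul_of_pos_left _ (Nat.pos_of_ne_zero hm)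
  exact_mod_cast (by omega : n < m * (k + 1))

open scoped PowerSeries.WithPiTopology in
theorem constantCoeff_qInf {m : ℕ} (hm : m ≠ 0) : constantCoeff (qInf m) = 1 := by
  have h := (multipliable_qInf hm).hasProd.map (constantCoeff (R := ℤ))
    (PowerSeries.WithPiTopology.continuous_constantCoeff ℤ)
  have h1 : (fun k : ℕ => constantCoeff (1 - (X : ℤ⟦X⟧) ^ (m * (k + 1)))) = fun _ => 1 := by
    funext k
    simp [hm]
  have h2 : HasProd (fun k : ℕ => constantCoeff (1 - (X : ℤ⟦X⟧) ^ (m * (k + 1))))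
      (constantCoeff (qInf m)) := h
  rw [h1] at h2
  exact h2.unique hasProd_one

/-- `1 / (q^m)_∞^n` as a formal power series over `ℤ`. -/
noncomputable def qInfInv (m n : ℕ) : ℤ⟦X⟧ := invOfUnit (qInf m ^ n) 1

theorem qInf_pow_mul_qInfInv {m : ℕ} (hm : m ≠ 0) (n : ℕ) : qInf m ^ n * qInfInv m n = 1 :=
  mul_invOfUnit _ _ (by simp [constantCoeff_qInf hm])

/-- With `(q)_∞ = ∑ bₙ qⁿ`, the series `(1 / (q^7)_∞) * ∑ₙ b_{7n+r} qⁿ`: the component of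
`(q^{1/7})_∞ / (q^7)_∞` whose exponents are congruent to `r / 7` modulo `1`, stripped of
the factor `q^{r/7}`. -/
noncomputable def dissection (r : ℕ) : ℤ⟦X⟧ :=
  qInfInv 7 1 * PowerSeries.mk fun n => coeff (7 * n + r) (qInf 1)

noncomputable def J₁ : ℤ⟦X⟧ := dissection 0
noncomputable def J₂ : ℤ⟦X⟧ := dissection 1
noncomputable def J₃ : ℤ⟦X⟧ := dissection 5

/-- `H a` is the series usually written `H_{1+a}`. -/
noncomputable def H : Fin 7 → ℤ⟦X⟧ :=
  ![2 * J₁ ^ 2 * J₂ ^ 8 + 2 * J₁ ^ 3 * J₂ ^ 6 - J₁ ^ 4 * J₂ ^ 4 - 13 * J₁ ^ 5 * J₂ ^ 2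
      + 11 * J₁ ^ 6,
    5 * J₁ ^ 2 * J₂ ^ 7 - 9 * J₁ ^ 3 * J₂ ^ 5 + 15 * J₁ ^ 4 * J₂ ^ 3 - 15 * J₁ ^ 5 * J₂
      - 3 * J₁ ^ 7 * J₃,
    11 * J₁ ^ 2 * J₂ ^ 6 - 31 * J₁ ^ 3 * J₂ ^ 4 + 26 * J₁ ^ 4 * J₂ ^ 2 - 5 * J₁ ^ 5
      + J₁ ^ 8 * J₃ ^ 2,
    J₁ * J₂ ^ 7 + 8 * J₁ ^ 2 * J₂ ^ 5 - 18 * J₁ ^ 3 * J₂ ^ 3 + 11 * J₁ ^ 4 * J₂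
      + 5 * J₁ ^ 6 * J₃,
    3 * J₁ * J₂ ^ 6 + 3 * J₁ ^ 2 * J₂ ^ 4 - 12 * J₁ ^ 3 * J₂ ^ 2 + 12 * J₁ ^ 4
      - J₁ ^ 7 * J₃ ^ 2,
    7 * J₁ * J₂ ^ 5 - 7 * J₁ ^ 2 * J₂ ^ 3 - 14 * J₁ ^ 3 * J₂ - 7 * J₁ ^ 5 * J₃,
    J₂ ^ 6 + J₁ * J₂ ^ 4 + 17 * J₁ ^ 2 * J₂ ^ 2 - 10 * J₁ ^ 3 + 2 * J₁ ^ 6 * J₃ ^ 2]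

/-- The partition function `p(n)`. -/
def partitionNumber (n : ℕ) : ℕ := Fintype.card (Nat.Partition n)

/-- The `(k+1) × (k+1)` matrix whose last column is `Z₀, …, Z_k` and whose other columns are
those of the lower-triangular Toeplitz matrix with entries `D_{i-j}` (`i ≥ j`), where
`Dₙ` and `Zₙ` are the coefficients of the power series `D` and `Z`. -/
noncomputable def toeplitzLastCol (D Z : ℤ⟦X⟧) (k : ℕ) : Matrix (Fin (k + 1)) (Fin (k + 1)) ℤ :=
  Matrix.of fun i j =>
    if j = Fin.last k then coeff (i : ℕ) Z
    else if j ≤ i then coeff ((i : ℕ) - (j : ℕ)) D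
    else 0

/-! Everything rests on two relations between the dissection components, `J₁ * J₂ * J₃ = -1` and `X
* J₃ = J₁ ^ 2 - J₁ * J₂ ^ 2`. The pentagonal number theorem makes three of the seven components of
$(q)_\infty$ vanish and gives the one in residue 2 explicitly. Cubing this dissection and comparing
with Jacobi's series $(q)_\infty^3=\sum(-1)^k(2k+1)q^{k(k+1)/2}$, whose components in residues 2 and
6 modulo 7 are known, yields the relations. Jacobi's identity is itself proved here, from a finite
$q$-binomial version.

Next take the norm of $x\mapsto J_1+xJ_2-x^2+x^5J_3$ (with $x^7=q$) over the seventh roots of unity.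
On the product side it is $(q)_\infty^8/(q^7)_\infty^8$; on the algebraic side the relations turn it
into the square of a polynomial $W$ in the $J_i$ (`dissectionNorm`). The constant term fixes the
sign of the square root, so $(q)_\infty^4=(q^7)_\infty^4W$.

The $H_a$ are the coefficients of the cofactor: $(J_1+xJ_2-x^2+x^5J_3)\sum_a x^aH_{1+a}=W^2$ modulo
the relations (`dissection_mul_H`). Hence $\sum_a x^aH_{1+a}$ is, up to known products, the
7-dissection of $1/(q)_\infty$, which is (i). Part (ii) is Cramer's rule for a unitriangular
Toeplitz system. Part (iii) holds since $H_6-7W=49(J_1^2J_2^3-J_1^3J_2)=49q$. -/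

/-! ### Euler products and the partition generating function. -/

open scoped PowerSeries.WithPiTopology in
theorem hasProd_qInf {m : ℕ} (hm : m ≠ 0) :
    HasProd (fun k : ℕ => 1 - (X : ℤ⟦X⟧) ^ (m * (k + 1))) (qInf m) :=
  (multipliable_qInf hm).hasProd

theorem qInf_ne_zero {m : ℕ} (hm : m ≠ 0) : qInf m ≠ 0 := by
  intro h
  have := constantCoeff_qInf hm
  simp [h] at this

open scoped PowerSeries.WithPiTopology in
theorem PowerSeries.continuous_of_continuous_coeff {R S F : Type*} [Semiring R] [Semiring S]
    [TopologicalSpace R] [TopologicalSpace S] [FunLike F R⟦X⟧ S⟦X⟧] (φ : F)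
    (h : ∀ n, Continuous fun f : R⟦X⟧ => coeff n (φ f)) : Continuous φ := by
  rw [continuous_iff_continuousAt]
  intro f
  rw [ContinuousAt, WithPiTopology.tendsto_iff_coeff_tendsto]
  exact fun d => (h d).tendsto f

open scoped PowerSeries.WithPiTopology in
theorem PowerSeries.continuous_expand {R : Type*} [CommRing R] [TopologicalSpace R] {m : ℕ}
    (hm : m ≠ 0) : Continuous (expand (R := R) m hm) := by
  refine continuous_of_continuous_coeff _ fun n => ?_
  by_cases h : m ∣ n
  · simpa [coeff_expand, h] using WithPiTopology.continuous_coeff R (n / m)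
  · simpa [coeff_expand, h] using continuous_const

open scoped PowerSeries.WithPiTopology in
theorem expand_qInf {m n : ℕ} (hm : m ≠ 0) (hn : n ≠ 0) :
    expand m hm (qInf n) = qInf (m * n) := by
  have h := (hasProd_qInf hn).map (expand (R := ℤ) m hm) (continuous_expand hm)
  refine h.unique ?_
  convert hasProd_qInf (mul_ne_zero hm hn) using 1
  funext k
  simp [← pow_mul, mul_assoc]

open scoped PowerSeries.WithPiTopology in
theorem qInf_one_eq_pentagonalSeries : qInf 1 = pentagonalSeries ℤ := by
  simp only [qInf, one_mul]
  exact WithPiTopology.tprod_one_sub_X_pow ℤ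

-- Factor by factor, the Euler product of the partition series is a geometric series inverse to
-- $1-q^{i+1}$.
open scoped PowerSeries.WithPiTopology in
theorem qInf_one_mul_mk_partitionNumber :
    qInf 1 * PowerSeries.mk (fun n => (partitionNumber n : ℤ)) = 1 := by
  have h1 := Nat.Partition.hasProd_genFun (R := ℤ) (fun _ _ => 1)
  have h2 : Nat.Partition.genFun (R := ℤ) (fun _ _ => 1) =
      PowerSeries.mk (fun n => (partitionNumber n : ℤ)) := by
    ext n
    simp [partitionNumber, Finsupp.prod]
  rw [h2] at h1
  have h3 := (hasProd_qInf one_ne_zero).mul h1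
  refine h3.unique ?_
  convert hasProd_one with i
  have h4 : Summable fun j : ℕ => ((X : ℤ⟦X⟧) ^ (i + 1)) ^ j :=
    WithPiTopology.summable_pow_of_constantCoeff_eq_zero (by simp)
  have h5 := WithPiTopology.one_sub_mul_tsum_pow_of_constantCoeff_eq_zero
    (f := (X : ℤ⟦X⟧) ^ (i + 1)) (by simp)
  rw [h4.tsum_eq_zero_add] at h5
  simp only [pow_zero] at h5
  simp only [pow_mul, pow_one]
  exact (congrArg (fun g => (1 - (X : ℤ⟦X⟧) ^ (i + 1)) * (1 + ∑' j : ℕ, g j))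
    (funext fun j => one_smul ℤ (((X : ℤ⟦X⟧) ^ (i + 1)) ^ (j + 1)))).trans h5

/-! ### Splitting a power series by exponents modulo 7. -/

/-- The series `∑ₙ a_{7n+r} qⁿ` for `f = ∑ₙ aₙ qⁿ`. -/
noncomputable def residuePart (r : ℕ) : ℤ⟦X⟧ →+ ℤ⟦X⟧ where
  toFun f := PowerSeries.mk fun n => coeff (7 * n + r) f
  map_zero' := by ext; simp
  map_add' f g := by ext; simp

theorem coeff_residuePart (r n : ℕ) (f : ℤ⟦X⟧) :
    coeff n (residuePart r f) = coeff (7 * n + r) f := by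
  simp [residuePart]

theorem residuePart_X_pow_mul_expand {r s : ℕ} (hr : r < 7) (hs : s < 7) (f : ℤ⟦X⟧) :
    residuePart s (X ^ r * expand 7 (by norm_num) f) = if r = s then f else 0 := by
  ext n
  rw [coeff_residuePart, coeff_X_pow_mul', coeff_expand]
  split_ifs with h1 h2 h3 h3 h2
  · congr 1
    congr 1
    omega
  · omega
  · omega
  · simp
  · omega
  · simp

theorem sum_X_pow_mul_expand_residuePart (f : ℤ⟦X⟧) :
    f = ∑ r ∈ Finset.range 7, X ^ r * expand 7 (by norm_num) (residuePart r f) := by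
  ext n
  obtain ⟨k, s, hs, rfl⟩ : ∃ k s, s < 7 ∧ n = 7 * k + s :=
    ⟨n / 7, n % 7, Nat.mod_lt _ (by norm_num), (Nat.div_add_mod n 7).symm⟩
  rw [← coeff_residuePart, ← coeff_residuePart, map_sum,
    Finset.sum_congr rfl fun r hr =>
      residuePart_X_pow_mul_expand (Finset.mem_range.mp hr) hs (residuePart r f),
    Finset.sum_ite_eq' , if_pos (Finset.mem_range.mpr hs)]

/-- Uniqueness of the 7-dissection: this is what allows components to be compared. -/
theorem residuePart_sum {s : ℕ} (hs : s < 7) (f : ℕ → ℤ⟦X⟧) :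
    residuePart s (∑ r ∈ Finset.range 7, X ^ r * expand 7 (by norm_num) (f r)) = f s := by
  rw [map_sum, Finset.sum_congr rfl fun r hr =>
      residuePart_X_pow_mul_expand (Finset.mem_range.mp hr) hs (f r),
    Finset.sum_ite_eq' , if_pos (Finset.mem_range.mpr hs)]

/-! ### The 7-dissection of $(q)_\infty$ from pentagonal numbers. -/

theorem coeff_qInf_one_pentagonal (k : ℤ) : coeff (pentagonal k) (qInf 1) = (Int.negOnePow k : ℤˣ) := by
  rw [qInf_one_eq_pentagonalSeries, coeff_pentagonalSeries_pentagonal, Int.cast_id]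

theorem coeff_qInf_one_eq_zero {n : ℕ} (h : ∀ k, pentagonal k ≠ n) : coeff n (qInf 1) = 0 := by
  rw [qInf_one_eq_pentagonalSeries, coeff_pentagonalSeries_eq_zero]
  rintro ⟨k, hk⟩
  exact h k hk

theorem two_mul_emod_seven_of_pentagonal {n : ℕ} {k : ℤ} (h : pentagonal k = n) :
    2 * (n : ℤ) % 7 = k % 7 * (3 * (k % 7) - 1) % 7 := by
  rw [← h, two_mul_natCast_pentagonal]
  simp [Int.mul_emod, Int.sub_emod]

/-- Pentagonal numbers are congruent to 0, 1, 2 or 5 modulo 7. -/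
theorem residuePart_qInf_one_eq_zero {r : ℕ} (hr : r = 3 ∨ r = 4 ∨ r = 6) :
    residuePart r (qInf 1) = 0 := by
  ext n
  rw [coeff_residuePart, coeff_qInf_one_eq_zero, map_zero]
  intro k hk
  have h := two_mul_emod_seven_of_pentagonal hk
  have h1 := Int.emod_nonneg k (show (7 : ℤ) ≠ 0 by norm_num)
  have h2 := Int.emod_lt_of_pos k (show (0 : ℤ) < 7 by norm_num)
  generalize k % 7 = j at *
  push_cast at h
  interval_cases j <;> omega

theorem pentagonal_seven_mul_sub_one (k : ℤ) : pentagonal (7 * k - 1) = 49 * pentagonal k + 2 := by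
  have h1 := two_mul_natCast_pentagonal (7 * k - 1)
  have h2 := two_mul_natCast_pentagonal k
  zify
  linarith

/-- Residue 2 occurs only for $k=7j-1$, where the pentagonal number is 49 times the $j$-th one plus
2. The pentagonal series thus reproduces itself in $q^7$, with a minus sign because $7j-1$ and $j$
have opposite parity. -/
theorem residuePart_two_qInf_one : residuePart 2 (qInf 1) = -qInf 7 := by
  rw [← mul_one 7, ← expand_qInf (by norm_num) one_ne_zero]
  ext n
  rw [coeff_residuePart, map_neg, coeff_expand]
  by_cases hex : ∃ k, pentagonal k = 7 * n + 2
  · obtain ⟨k, hk⟩ := hex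
    obtain ⟨j, rfl⟩ : ∃ j, k = 7 * j - 1 := by
      have h := two_mul_emod_seven_of_pentagonal hk
      have h1 := Int.emod_nonneg k (show (7 : ℤ) ≠ 0 by norm_num)
      have h2 := Int.emod_lt_of_pos k (show (0 : ℤ) < 7 by norm_num)
      refine ⟨(k + 1) / 7, ?_⟩
      have h3 : k % 7 = 6 := by
        generalize k % 7 = j at *
        push_cast at h
        interval_cases j <;> omega
      omega
    rw [← hk, coeff_qInf_one_pentagonal]
    rw [pentagonal_seven_mul_sub_one] at hk
    obtain rfl : n = 7 * pentagonal j := by omega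
    rw [if_pos (dvd_mul_right _ _), Nat.mul_div_cancel_left _ (by norm_num),
      coeff_qInf_one_pentagonal]
    have : (7 * j - 1).negOnePow = -j.negOnePow := by
      rw [show 7 * j - 1 = j + 2 * (3 * j - 1) + 1 by ring, Int.negOnePow_succ,
        Int.negOnePow_add, Int.negOnePow_even _ (even_two_mul _), mul_one]
    rw [this]
    simp
  · rw [coeff_qInf_one_eq_zero fun k hk => hex ⟨k, hk⟩]
    split_ifs with h7
    · obtain ⟨m, rfl⟩ := h7
      rw [Nat.mul_div_cancel_left _ (by norm_num), coeff_qInf_one_eq_zero, neg_zero]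
      rintro k rfl
      exact hex ⟨7 * k - 1, by rw [pentagonal_seven_mul_sub_one]; ring⟩
    · simp

theorem qInf_seven_mul_dissection (r : ℕ) : qInf 7 * dissection r = residuePart r (qInf 1) := by
  have h := qInf_pow_mul_qInfInv (show 7 ≠ 0 by norm_num) 1
  rw [pow_one] at h
  rw [dissection, ← mul_assoc, h, one_mul]
  rfl

theorem qInf_one_eq_qInf_mul_dissection :
    qInf 1 = qInf 49 * (expand 7 (by norm_num) J₁ + X * expand 7 (by norm_num) J₂ - X ^ 2
        + X ^ 5 * expand 7 (by norm_num) J₃) := by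
  have h49 : expand 7 (by norm_num) (qInf 7) = qInf 49 := expand_qInf (by norm_num) (by norm_num)
  conv_lhs => rw [sum_X_pow_mul_expand_residuePart (qInf 1)]
  simp only [Finset.sum_range_succ, Finset.sum_range_zero,
    residuePart_qInf_one_eq_zero (r := 3) (by simp),
    residuePart_qInf_one_eq_zero (r := 4) (by simp),
    residuePart_qInf_one_eq_zero (r := 6) (by simp), residuePart_two_qInf_one]
  simp only [← qInf_seven_mul_dissection, map_mul, map_neg, map_zero, h49, J₁, J₂, J₃]
  ring

theorem qInf_one_mul_qInfInv :
    qInf 1 * qInfInv 49 1 = expand 7 (by norm_num) J₁ + X * expand 7 (by norm_num) J₂ - X ^ 2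
        + X ^ 5 * expand 7 (by norm_num) J₃ := by
  have h := qInf_pow_mul_qInfInv (show 49 ≠ 0 by norm_num) 1
  rw [pow_one] at h
  rw [qInf_one_eq_qInf_mul_dissection, mul_right_comm, h, one_mul]

/-! ### Gaussian binomials and the $q$-binomial theorem. -/

section qBinomial

variable {R : Type*} [CommRing R] (q : R)

/-- The finite `q`-Pochhammer symbol `(q; q)_n`. -/
def qPoch (n : ℕ) : R := ∏ i ∈ Finset.range n, (1 - q ^ (i + 1))

/-- The Gaussian binomial coefficient of `i + j` over `i`. -/
def gaussBinom : ℕ → ℕ → R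
  | 0, _ => 1
  | _ + 1, 0 => 1
  | i + 1, j + 1 => gaussBinom i (j + 1) + q ^ (i + 1) * gaussBinom (i + 1) j

theorem gaussBinom_zero_left (j : ℕ) : gaussBinom q 0 j = 1 := by
  simp [gaussBinom]

theorem gaussBinom_zero_right (i : ℕ) : gaussBinom q i 0 = 1 := by
  cases i <;> simp [gaussBinom]

theorem gaussBinom_succ_succ (i j : ℕ) : gaussBinom q (i + 1) (j + 1) =
    gaussBinom q i (j + 1) + q ^ (i + 1) * gaussBinom q (i + 1) j := by
  simp [gaussBinom]

theorem qPoch_succ (n : ℕ) : qPoch q (n + 1) = qPoch q n * (1 - q ^ (n + 1)) :=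
  Finset.prod_range_succ _ _

theorem qPoch_mul_qPoch_mul_gaussBinom (i j : ℕ) :
    qPoch q i * qPoch q j * gaussBinom q i j = qPoch q (i + j) := by
  induction i generalizing j with
  | zero => simp [gaussBinom_zero_left, qPoch]
  | succ i ih =>
    induction j with
    | zero => simp [gaussBinom_zero_right, qPoch]
    | succ j ihj =>
      have h1 := ih (j + 1)
      rw [show i + 1 + j = i + (j + 1) by ring] at ihj
      rw [gaussBinom_succ_succ, show i + 1 + (j + 1) = i + (j + 1) + 1 by ring, qPoch_succ q (i + _)]
      linear_combination (1 - q ^ (i + 1)) * h1 + q ^ (i + 1) * (1 - q ^ (j + 1)) * ihj +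
        gaussBinom q i (j + 1) * qPoch q (j + 1) * qPoch_succ q i +
        q ^ (i + 1) * gaussBinom q (i + 1) j * qPoch q (i + 1) * qPoch_succ q j

/-- The polynomial `∏_{i < n} (x - q^i)`. -/
noncomputable def qFallingPoly (n : ℕ) : Polynomial R :=
  ∏ i ∈ Finset.range n, (Polynomial.X - Polynomial.C (q ^ i))

theorem qFallingPoly_succ (n : ℕ) :
    qFallingPoly q (n + 1) = qFallingPoly q n * (Polynomial.X - Polynomial.C (q ^ n)) :=
  Finset.prod_range_succ _ _

theorem qFallingPoly_natDegree_le (n : ℕ) : (qFallingPoly q n).natDegree ≤ n := by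
  refine (Polynomial.natDegree_prod_le _ _).trans ?_
  refine (Finset.sum_le_card_nsmul _ _ 1 fun i _ => Polynomial.natDegree_X_sub_C_le _).trans ?_
  simp

theorem coeff_qFallingPoly_self (n : ℕ) : (qFallingPoly q n).coeff n = 1 := by
  induction n with
  | zero => simp [qFallingPoly]
  | succ n ih =>
    rw [qFallingPoly_succ, Polynomial.coeff_mul_X_sub_C, ih,
      Polynomial.coeff_eq_zero_of_natDegree_lt
        ((qFallingPoly_natDegree_le q n).trans_lt n.lt_succ_self)]
    simp

/-- The `q`-binomial theorem. -/
theorem coeff_qFallingPoly (i j : ℕ) :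
    (qFallingPoly q (i + j)).coeff i = (-1) ^ j * q ^ (j.choose 2) * gaussBinom q i j := by
  have hc (j : ℕ) : (j + 1).choose 2 = j + j.choose 2 := by
    rw [Nat.choose_succ_succ' j 1, Nat.choose_one_right]
  induction i generalizing j with
  | zero =>
    rw [gaussBinom_zero_left, zero_add]
    induction j with
    | zero => simp [qFallingPoly]
    | succ j ih =>
      rw [qFallingPoly_succ, mul_sub, Polynomial.coeff_sub, Polynomial.coeff_mul_C, ih,
        Polynomial.mul_coeff_zero, Polynomial.coeff_X_zero, hc]
      ring
  | succ i ih =>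
    induction j with
    | zero =>
      rw [gaussBinom_zero_right]
      simpa using coeff_qFallingPoly_self q (i + 1)
    | succ j ihj =>
      rw [gaussBinom_succ_succ, ← add_assoc, qFallingPoly_succ, Polynomial.coeff_mul_X_sub_C,
        show i + 1 + j = i + (j + 1) by ring, ih, ← show i + 1 + j = i + (j + 1) by ring, ihj, hc]
      ring

theorem prod_pow_sub_pow (n : ℕ) : ∏ i ∈ Finset.range n, (q ^ n - q ^ i) =
    (-1) ^ n * q ^ (n.choose 2) * qPoch q n := by
  have h1 : ∀ i ∈ Finset.range n, q ^ n - q ^ i = -1 * q ^ i * (1 - q ^ (n - 1 - i + 1)) := by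
    intro i hi
    have := Finset.mem_range.mp hi
    rw [show n - 1 - i + 1 = n - i by omega]
    have h2 : q ^ n = q ^ i * q ^ (n - i) := by rw [← pow_add]; congr 1; omega
    rw [h2]
    ring
  rw [Finset.prod_congr rfl h1, Finset.prod_mul_distrib, Finset.prod_mul_distrib,
    Finset.prod_pow_eq_pow_sum, Finset.sum_range_id, ← Nat.choose_two_right,
    Finset.prod_range_reflect (fun i => 1 - q ^ (i + 1)), qPoch]
  simp

theorem eval_derivative_qFallingPoly (n : ℕ) :
    (qFallingPoly q (2 * n + 1)).derivative.eval (q ^ n) =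
      (-1) ^ n * q ^ (n.choose 2 + n * n) * qPoch q n ^ 2 := by
  have h : qFallingPoly q (2 * n + 1) = (Polynomial.X - Polynomial.C (q ^ n)) *
      ((∏ i ∈ Finset.range n, (Polynomial.X - Polynomial.C (q ^ i))) *
        ∏ i ∈ Finset.range n, (Polynomial.X - Polynomial.C (q ^ (n + 1 + i)))) := by
    rw [qFallingPoly, show 2 * n + 1 = (n + 1) + n by ring, Finset.prod_range_add,
      Finset.prod_range_succ]
    ring
  have h2 : ∏ i ∈ Finset.range n, (q ^ n - q ^ (n + 1 + i)) = q ^ (n * n) * qPoch q n := by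
    rw [qPoch, pow_mul]
    conv_rhs => rw [← Finset.card_range n, ← Finset.prod_const, Finset.card_range n,
      ← Finset.prod_mul_distrib]
    exact Finset.prod_congr rfl fun i _ => by ring
  rw [h, Polynomial.derivative_mul, Polynomial.eval_add, Polynomial.eval_mul, Polynomial.eval_mul,
    Polynomial.eval_mul, Polynomial.eval_prod, Polynomial.eval_prod]
  simp only [Polynomial.eval_sub, Polynomial.eval_X, Polynomial.eval_C, prod_pow_sub_pow, h2,
    sub_self, zero_mul, add_zero, Polynomial.derivative_X_sub_C, Polynomial.eval_one, one_mul]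
  ring

end qBinomial

/-! ### Jacobi's identity for $(q)_\infty^3$. -/

theorem Nat.two_mul_choose_two_add (m : ℕ) : 2 * m.choose 2 + m = m * m := by
  induction m with
  | zero => rfl
  | succ m ih =>
    rw [Nat.choose_succ_succ' m 1, Nat.choose_one_right]
    linarith

theorem constantCoeff_qPoch_X (n : ℕ) : constantCoeff (qPoch (X : ℤ⟦X⟧) n) = 1 := by
  simp [qPoch]

theorem qPoch_X_ne_zero (n : ℕ) : qPoch (X : ℤ⟦X⟧) n ≠ 0 := by
  intro h
  have := constantCoeff_qPoch_X n
  simp [h] at this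

theorem gaussBinom_X_comm (i j : ℕ) :
    gaussBinom (X : ℤ⟦X⟧) i j = gaussBinom X j i := by
  refine mul_left_cancel₀ (mul_ne_zero (qPoch_X_ne_zero i) (qPoch_X_ne_zero j)) ?_
  rw [qPoch_mul_qPoch_mul_gaussBinom, mul_comm (qPoch X i), qPoch_mul_qPoch_mul_gaussBinom,
    add_comm]

/-- Differentiating $\prod_{i\le 2n}(x-q^i)$ at its middle root $q^n$ gives a product, computed in
`eval_derivative_qFallingPoly`. Here the same value is expanded by the $q$-binomial theorem; the
factor $q^n$ turns $f'$ into $xf'$, so that each coefficient is weighted by its own degree. -/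
theorem X_pow_mul_eval_derivative_qFallingPoly (n : ℕ) :
    (X : ℤ⟦X⟧) ^ n * (qFallingPoly X (2 * n + 1)).derivative.eval (X ^ n) =
      X ^ (n.choose 2 + n * n + n) * ∑ k ∈ Finset.range (n + 1), (-1) ^ (n + k) * (2 * (k : ℤ⟦X⟧) + 1) *
        X ^ (k + 1).choose 2 * gaussBinom X (n + 1 + k) (n - k) := by
  set f : Polynomial ℤ⟦X⟧ := qFallingPoly X (2 * n + 1) with hf
  have h1 : (X : ℤ⟦X⟧) ^ n * f.derivative.eval (X ^ n) =
      ∑ m ∈ Finset.range ((n + 1) + (n + 1)), f.coeff m * (m : ℤ⟦X⟧) * (X ^ n) ^ m := by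
    have hd : (Polynomial.X * f.derivative).natDegree < (n + 1) + (n + 1) := by
      have h2 : f.natDegree ≤ 2 * n + 1 := qFallingPoly_natDegree_le X (2 * n + 1)
      have h3 := Polynomial.natDegree_derivative_le f
      have h4 := Polynomial.natDegree_mul_le (p := (Polynomial.X : Polynomial ℤ⟦X⟧))
        (q := f.derivative)
      have h5 := Polynomial.natDegree_X_le (R := ℤ⟦X⟧)
      omega
    have h6 := Polynomial.eval_eq_sum_range' hd (X ^ n : ℤ⟦X⟧)
    rw [Polynomial.eval_mul, Polynomial.eval_X] at h6
    rw [h6]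
    refine Finset.sum_congr rfl fun m _ => ?_
    cases m with
    | zero => simp
    | succ m => rw [Polynomial.coeff_X_mul, Polynomial.coeff_derivative]; push_cast; ring
  -- Pair degree $n-k$ with degree $n+1+k$: the two terms have the same power of $q$ and the same
  -- Gaussian binomial but opposite signs, so the weights combine to $(n+1+k)-(n-k)=2k+1$.
  rw [h1, Finset.sum_range_add, ← Finset.sum_range_reflect, ← Finset.sum_add_distrib,
    Finset.mul_sum]
  refine Finset.sum_congr rfl fun k hk => ?_
  obtain ⟨j, rfl⟩ := Nat.exists_eq_add_of_le (Nat.lt_succ_iff.mp (Finset.mem_range.mp hk))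
  rw [show k + j + 1 - 1 - k = j by omega, show k + j - k = j by omega]
  have hj := Nat.two_mul_choose_two_add j
  have hk := Nat.two_mul_choose_two_add (k + 1)
  have hkj := Nat.two_mul_choose_two_add (k + j)
  have hkj' := Nat.two_mul_choose_two_add (k + j + 1 + k)
  have e1 : f.coeff (k + j + 1 + k) =
      (-1) ^ j * X ^ (j.choose 2) * gaussBinom X (k + j + 1 + k) j := by
    rw [hf, ← coeff_qFallingPoly]; congr 2; ring
  have e2 : f.coeff j = (-1) ^ (k + j + 1 + k) * X ^ ((k + j + 1 + k).choose 2) *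
      gaussBinom X (k + j + 1 + k) j := by
    rw [hf, gaussBinom_X_comm, ← coeff_qFallingPoly]; congr 2; ring
  have e3 : j.choose 2 + (k + j) * (k + j + 1 + k) =
      (k + j).choose 2 + (k + j) * (k + j) + (k + j) + (k + 1).choose 2 := by
    zify at *
    linarith
  have e4 : (k + j + 1 + k).choose 2 + (k + j) * j =
      (k + j).choose 2 + (k + j) * (k + j) + (k + j) + (k + 1).choose 2 := by
    zify at *
    linarith
  have e5 : (-1 : ℤ⟦X⟧) ^ (k + j + k) = (-1) ^ j := by
    rw [show k + j + k = j + 2 * k by ring, pow_add, pow_mul]; simp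
  have e6 : (-1 : ℤ⟦X⟧) ^ (k + j + 1 + k) = -(-1) ^ j := by
    rw [show k + j + 1 + k = k + j + k + 1 by ring, pow_succ, e5]; simp
  have e3' := congrArg (fun e => (X : ℤ⟦X⟧) ^ e) e3
  have e4' := congrArg (fun e => (X : ℤ⟦X⟧) ^ e) e4
  simp only [pow_add _ _ ((k + 1).choose 2), pow_add _ (j.choose 2),
    pow_add _ ((k + j + 1 + k).choose 2), pow_mul] at e3' e4'
  rw [e1, e2, e5, e6]
  push_cast
  linear_combination (-1) ^ j * gaussBinom X (k + j + 1 + k) j * (k + j + 1 + k) * e3' -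
    (-1) ^ j * gaussBinom X (k + j + 1 + k) j * j * e4'

/-- The finite form of Jacobi's identity for the cube of `(q)_∞`. -/
theorem qPoch_X_sq (n : ℕ) : qPoch (X : ℤ⟦X⟧) n ^ 2 =
    ∑ k ∈ Finset.range (n + 1), (-1) ^ k * (2 * (k : ℤ⟦X⟧) + 1) *
        X ^ (k + 1).choose 2 * gaussBinom X (n + 1 + k) (n - k) := by
  have h1 := X_pow_mul_eval_derivative_qFallingPoly n
  rw [eval_derivative_qFallingPoly] at h1
  have h2 : (-1 : ℤ⟦X⟧) ^ n * (-1) ^ n = 1 := by rw [← mul_pow]; simp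
  have h3 : (X : ℤ⟦X⟧) ^ (n.choose 2 + n * n + n) * (-1) ^ n ≠ 0 := by simp
  refine mul_left_cancel₀ h3 ?_
  simp only [pow_add (-1 : ℤ⟦X⟧) n, mul_assoc, ← Finset.mul_sum] at h1 ⊢
  rw [← h1]
  ring

theorem X_pow_dvd_qPoch_sub {m n : ℕ} (h : m ≤ n) :
    (X : ℤ⟦X⟧) ^ (m + 1) ∣ qPoch X n - qPoch X m := by
  induction n, h using Nat.le_induction with
  | base => simp
  | succ n hn ih =>
    rw [qPoch_succ, show qPoch (X : ℤ⟦X⟧) n * (1 - X ^ (n + 1)) - qPoch X m =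
      (qPoch X n - qPoch X m) - X ^ (n + 1) * qPoch X n by ring]
    exact dvd_sub ih ((pow_dvd_pow X (by omega)).mul_right _)

open scoped PowerSeries.WithPiTopology in
theorem X_pow_dvd_qInf_one_sub_qPoch (m : ℕ) : (X : ℤ⟦X⟧) ^ (m + 1) ∣ qInf 1 - qPoch X m := by
  rw [X_pow_dvd_iff]
  intro d hd
  have h1 := (hasProd_qInf one_ne_zero).tendsto_prod_nat
  rw [WithPiTopology.tendsto_iff_coeff_tendsto] at h1
  have h2 := h1 d
  rw [map_sub, sub_eq_zero]
  refine tendsto_nhds_unique h2 (tendsto_const_nhds.congr' ?_)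
  filter_upwards [Filter.eventually_ge_atTop m] with n hn
  have h3 := X_pow_dvd_iff.mp (X_pow_dvd_qPoch_sub hn) d hd
  rw [map_sub, sub_eq_zero] at h3
  rw [← h3]
  simp [qPoch]

/-- The Gaussian binomial is $(q)_{i+j}/((q)_i(q)_j)$, and each of these three products agrees with
$(q)_\infty$ modulo $q^{j+1}$. -/
theorem X_pow_dvd_qInf_one_mul_gaussBinom_sub_one {i j : ℕ} (h : j ≤ i) :
    (X : ℤ⟦X⟧) ^ (j + 1) ∣ qInf 1 * gaussBinom X i j - 1 := by
  have hE : IsUnit (qInf 1) := by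
    rw [isUnit_iff_constantCoeff, constantCoeff_qInf one_ne_zero]; exact isUnit_one
  rw [← (hE.dvd_mul_left : _ ∣ qInf 1 * _ ↔ _)]
  have hj := X_pow_dvd_qInf_one_sub_qPoch j
  have hi := (pow_dvd_pow (X : ℤ⟦X⟧) (show j + 1 ≤ i + 1 by omega)).trans
    (X_pow_dvd_qInf_one_sub_qPoch i)
  have hij := (pow_dvd_pow (X : ℤ⟦X⟧) (show j + 1 ≤ i + j + 1 by omega)).trans
    (X_pow_dvd_qInf_one_sub_qPoch (i + j))
  have h1 := qPoch_mul_qPoch_mul_gaussBinom (X : ℤ⟦X⟧) i j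
  have h2 : qInf 1 * (qInf 1 * gaussBinom X i j - 1) =
      (qInf 1 - qPoch X j) * (qInf 1 * gaussBinom X i j) +
      (qInf 1 - qPoch X i) * (qPoch X j * gaussBinom X i j) - (qInf 1 - qPoch X (i + j)) := by
    linear_combination h1
  rw [h2]
  exact dvd_sub (dvd_add (hj.mul_right _) (hi.mul_right _)) hij

/-- Multiply the finite identity by $(q)_\infty$. The Gaussian binomial in the $k$-th term is right
only modulo $q^{n-k+1}$, but its prefactor $q^{k(k+1)/2}$ is divisible by $q^k$. -/
theorem X_pow_dvd_qInf_one_pow_three_sub (n : ℕ) : (X : ℤ⟦X⟧) ^ (n + 1) ∣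
    qInf 1 ^ 3 - ∑ k ∈ Finset.range (n + 1), (-1) ^ k * (2 * (k : ℤ⟦X⟧) + 1) * X ^ (k + 1).choose 2 := by
  have h1 : (X : ℤ⟦X⟧) ^ (n + 1) ∣ qInf 1 * qPoch X n ^ 2 -
      ∑ k ∈ Finset.range (n + 1), (-1) ^ k * (2 * (k : ℤ⟦X⟧) + 1) * X ^ (k + 1).choose 2 := by
    rw [qPoch_X_sq, Finset.mul_sum, ← Finset.sum_sub_distrib]
    refine Finset.dvd_sum fun k hk => ?_
    have hk' := Finset.mem_range.mp hk
    have h2 : (X : ℤ⟦X⟧) ^ (n + 1) ∣ X ^ (k + 1).choose 2 *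
        (qInf 1 * gaussBinom X (n + 1 + k) (n - k) - 1) := by
      have h3 := mul_dvd_mul (dvd_refl ((X : ℤ⟦X⟧) ^ (k + 1).choose 2))
        (X_pow_dvd_qInf_one_mul_gaussBinom_sub_one (show n - k ≤ n + 1 + k by omega))
      rw [← pow_add] at h3
      refine (pow_dvd_pow X ?_).trans h3
      rw [Nat.choose_succ_succ' k 1, Nat.choose_one_right]
      omega
    convert h2.mul_left ((-1) ^ k * (2 * (k : ℤ⟦X⟧) + 1)) using 1
    ring
  have h2 : qInf 1 ^ 3 - ∑ k ∈ Finset.range (n + 1), (-1) ^ k * (2 * (k : ℤ⟦X⟧) + 1) *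
      (X : ℤ⟦X⟧) ^ (k + 1).choose 2 = (qInf 1 - qPoch X n) * (qInf 1 * (qInf 1 + qPoch X n)) +
      (qInf 1 * qPoch X n ^ 2 - ∑ k ∈ Finset.range (n + 1), (-1) ^ k * (2 * (k : ℤ⟦X⟧) + 1) *
        X ^ (k + 1).choose 2) := by ring
  rw [h2]
  exact dvd_add ((X_pow_dvd_qInf_one_sub_qPoch n).mul_right _) h1

theorem coeff_qInf_one_pow_three (n : ℕ) : coeff n (qInf 1 ^ 3) =
    ∑ k ∈ Finset.range (n + 1), if n = (k + 1).choose 2 then (-1) ^ k * (2 * (k : ℤ) + 1) else 0 := by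
  have h := X_pow_dvd_iff.mp (X_pow_dvd_qInf_one_pow_three_sub n) n n.lt_succ_self
  rw [map_sub, sub_eq_zero] at h
  rw [h, map_sum]
  refine Finset.sum_congr rfl fun k _ => ?_
  have : ((-1) ^ k * (2 * k + 1) : ℤ⟦X⟧) = C ((-1) ^ k * (2 * (k : ℤ) + 1)) := by simp
  rw [this, coeff_C_mul, coeff_X_pow]
  simp

theorem coeff_qInf_one_pow_three_choose (k : ℕ) :
    coeff ((k + 1).choose 2) (qInf 1 ^ 3) = (-1) ^ k * (2 * (k : ℤ) + 1) := by
  have hinj : Function.Injective fun k : ℕ => (k + 1).choose 2 :=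
    (strictMono_nat_of_lt_succ fun k => by
      show (k + 1).choose 2 < (k + 1 + 1).choose (1 + 1)
      rw [Nat.choose_succ_succ' (k + 1) 1, Nat.choose_one_right]
      exact Nat.lt_add_of_pos_left k.succ_pos).injective
  rw [coeff_qInf_one_pow_three, Finset.sum_eq_single k]
  · simp
  · exact fun j _ hj => if_neg fun h => hj (hinj h).symm
  · intro h
    rw [Finset.mem_range, Nat.choose_succ_succ' k 1, Nat.choose_one_right] at h
    omega

theorem coeff_qInf_one_pow_three_eq_zero {n : ℕ} (h : ∀ k : ℕ, (k + 1).choose 2 ≠ n) :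
    coeff n (qInf 1 ^ 3) = 0 := by
  rw [coeff_qInf_one_pow_three]
  exact Finset.sum_eq_zero fun k _ => if_neg fun hk => h k hk.symm

/-! ### The 7-dissection of $(q)_\infty^3$ and the relations between the $J_i$. -/

theorem two_mul_emod_seven_of_choose_two {n k : ℕ} (h : (k + 1).choose 2 = n) :
    2 * n % 7 = k % 7 * (k % 7 + 1) % 7 := by
  have h1 : 2 * n = k * (k + 1) := by
    have := Nat.two_mul_choose_two_add (k + 1)
    rw [h] at this
    linarith
  rw [h1]
  simp [Nat.mul_mod, Nat.add_mod]

theorem residuePart_qInf_one_pow_three_eq_zero {r : ℕ} (hr : r = 2 ∨ r = 4 ∨ r = 5) :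
    residuePart r (qInf 1 ^ 3) = 0 := by
  ext n
  rw [coeff_residuePart, coeff_qInf_one_pow_three_eq_zero, map_zero]
  intro k hk
  have h := two_mul_emod_seven_of_choose_two hk
  have h2 := Nat.mod_lt k (show 7 > 0 by norm_num)
  generalize k % 7 = j at *
  interval_cases j <;> omega

theorem choose_two_seven_mul_add_four (k : ℕ) :
    (7 * k + 3 + 1).choose 2 = 49 * (k + 1).choose 2 + 6 := by
  have h1 := Nat.two_mul_choose_two_add (7 * k + 3 + 1)
  have h2 := Nat.two_mul_choose_two_add (k + 1)
  zify at *
  linarith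

/-- Triangular numbers are 6 modulo 7 only for $k=7j+3$, and then $2k+1=7(2j+1)$: Jacobi's series
reproduces itself with the factor $-7$. -/
theorem residuePart_six_qInf_one_pow_three :
    residuePart 6 (qInf 1 ^ 3) = -7 * qInf 7 ^ 3 := by
  have h1 : expand 7 (by norm_num) (qInf 1) = qInf 7 := expand_qInf (by norm_num) one_ne_zero
  rw [← h1, ← map_pow,
    show (-7 : ℤ⟦X⟧) = C (-7) by simp]
  ext n
  rw [coeff_residuePart, coeff_C_mul, coeff_expand]
  by_cases hex : ∃ k : ℕ, (k + 1).choose 2 = 7 * n + 6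
  · obtain ⟨k, hk⟩ := hex
    obtain ⟨j, rfl⟩ : ∃ j, k = 7 * j + 3 := by
      have h := two_mul_emod_seven_of_choose_two hk
      have h2 := Nat.mod_lt k (show 7 > 0 by norm_num)
      refine ⟨k / 7, ?_⟩
      have h3 : k % 7 = 3 := by
        generalize k % 7 = j at *
        interval_cases j <;> omega
      omega
    rw [← hk, coeff_qInf_one_pow_three_choose]
    rw [choose_two_seven_mul_add_four] at hk
    obtain rfl : n = 7 * (j + 1).choose 2 := by omega
    rw [if_pos (dvd_mul_right _ _), Nat.mul_div_cancel_left _ (by norm_num),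
      coeff_qInf_one_pow_three_choose]
    rw [show 7 * j + 3 = j + 2 * (3 * j + 1) + 1 by ring, pow_succ, pow_add, pow_mul]
    push_cast
    ring_nf
  · rw [coeff_qInf_one_pow_three_eq_zero fun k hk => hex ⟨k, hk⟩]
    split_ifs with h7
    · obtain ⟨m, rfl⟩ := h7
      rw [Nat.mul_div_cancel_left _ (by norm_num), coeff_qInf_one_pow_three_eq_zero, mul_zero]
      rintro k rfl
      exact hex ⟨7 * k + 3, by rw [choose_two_seven_mul_add_four]; ring⟩
    · simp

theorem qInf_one_pow_three_eq_sum : qInf 1 ^ 3 =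
    -- The cube of $J_1+xJ_2-x^2+x^5J_3$ collected by powers of $x$ modulo 7, with $x^7$ replaced by
    -- `X`. The components 2 and 6 give the two relations.
    ∑ r ∈ Finset.range 7, X ^ r * expand 7 (by norm_num) (qInf 7 ^ 3 * (match r with
      | 0 => J₁ ^ 3 + 3 * X * J₂ ^ 2 * J₃ - 6 * X * J₁ * J₃
      | 1 => 3 * J₁ ^ 2 * J₂ + X ^ 2 * J₃ ^ 3 - 6 * X * J₂ * J₃
      | 2 => 3 * (J₁ * J₂ ^ 2 - J₁ ^ 2 + X * J₃)
      | 3 => J₂ ^ 3 - 6 * J₁ * J₂ + 3 * X * J₁ * J₃ ^ 2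
      | 4 => 3 * (J₁ - J₂ ^ 2 + X * J₂ * J₃ ^ 2)
      | 5 => 3 * (J₁ ^ 2 * J₃ + J₂ - X * J₃ ^ 2)
      | _ => 6 * J₁ * J₂ * J₃ - 1)) := by
  have h49 : expand 7 (by norm_num) (qInf 7) = qInf 49 := expand_qInf (by norm_num) (by norm_num)
  rw [qInf_one_eq_qInf_mul_dissection]
  simp only [Finset.sum_range_succ, Finset.sum_range_zero, map_mul, map_add, map_sub, map_pow,
    map_ofNat, map_one, expand_X, h49]
  ring

theorem PowerSeries.ofNat_ne_zero (n : ℕ) [n.AtLeastTwo] :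
    (OfNat.ofNat n : ℤ⟦X⟧) ≠ 0 := by
  intro h
  have := congrArg constantCoeff h
  rw [map_ofNat, map_zero] at this
  exact _root_.OfNat.ofNat_ne_zero n this

theorem J₁_mul_J₂_mul_J₃ : J₁ * J₂ * J₃ = -1 := by
  have h := residuePart_six_qInf_one_pow_three
  rw [qInf_one_pow_three_eq_sum, residuePart_sum (by norm_num)] at h
  refine mul_left_cancel₀ (pow_ne_zero 3 (qInf_ne_zero (show 7 ≠ 0 by norm_num))) ?_
  refine mul_left_cancel₀ (PowerSeries.ofNat_ne_zero 6) ?_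
  change qInf 7 ^ 3 * (6 * J₁ * J₂ * J₃ - 1) = _ at h
  linear_combination h

theorem X_mul_J₃ : X * J₃ = J₁ ^ 2 - J₁ * J₂ ^ 2 := by
  have h := residuePart_qInf_one_pow_three_eq_zero (r := 2) (by simp)
  rw [qInf_one_pow_three_eq_sum, residuePart_sum (by norm_num)] at h
  refine mul_left_cancel₀ (pow_ne_zero 3 (qInf_ne_zero (show 7 ≠ 0 by norm_num))) ?_
  refine mul_left_cancel₀ (PowerSeries.ofNat_ne_zero 3) ?_
  change qInf 7 ^ 3 * (3 * (J₁ * J₂ ^ 2 - J₁ ^ 2 + X * J₃)) = _ at h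
  linear_combination h

theorem X_eq_J₁_J₂ : X = J₁ ^ 2 * J₂ ^ 3 - J₁ ^ 3 * J₂ := by
  linear_combination -J₁ * J₂ * X_mul_J₃ + X * J₁_mul_J₂_mul_J₃

/-! ### Norms over the seventh roots of unity. -/

section Cyclotomic

variable {R : Type*} [CommRing R]

/-- The $t_i$ model the cubic Gaussian periods $\zeta+\zeta^6$, $\zeta^2+\zeta^5$,
$\zeta^3+\zeta^4$, roots of $t^3+t^2-2t-1$. The three factors are the conjugates under their cyclic
permutation, so only cyclically symmetric expressions in the $t_i$ occur, and these are integers. -/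
theorem cubic_period_norm {t₁ t₂ t₃ : R} (h : t₁ + t₂ + t₃ = -1)
    (h₁₁ : t₁ ^ 2 = t₂ + 2) (h₂₂ : t₂ ^ 2 = t₃ + 2) (h₃₃ : t₃ ^ 2 = t₁ + 2)
    (h₁₂ : t₁ * t₂ = t₁ + t₃) (h₂₃ : t₂ * t₃ = t₁ + t₂) (h₃₁ : t₃ * t₁ = t₂ + t₃) (S P Q R' : R) :
    (S + t₁ * P + t₂ * Q + t₃ * R') * (S + t₂ * P + t₃ * Q + t₁ * R') *
        (S + t₃ * P + t₁ * Q + t₂ * R') =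
      S ^ 3 - S ^ 2 * (P + Q + R') + S * (-2 * (P ^ 2 + Q ^ 2 + R' ^ 2) +
        3 * (P * Q + Q * R' + R' * P)) + P ^ 3 + Q ^ 3 + R' ^ 3 +
        3 * (P ^ 2 * Q + Q ^ 2 * R' + R' ^ 2 * P) - 4 * (P ^ 2 * R' + Q ^ 2 * P + R' ^ 2 * Q) -
        P * Q * R' := by
  have e2 : t₁ * t₂ + t₂ * t₃ + t₃ * t₁ = -2 := by linear_combination h₁₂ + h₂₃ + h₃₁ + 2 * h
  have e3 : t₁ * t₂ * t₃ = 1 := by linear_combination t₃ * h₁₂ + h₃₁ + h₃₃ + h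
  have ea : t₁ ^ 2 * t₂ + t₂ ^ 2 * t₃ + t₃ ^ 2 * t₁ = 3 := by
    linear_combination t₂ * h₁₁ + t₃ * h₂₂ + t₁ * h₃₃ + h₁₁ + h₂₂ + h₃₃ + 3 * h
  have eb : t₁ ^ 2 * t₃ + t₂ ^ 2 * t₁ + t₃ ^ 2 * t₂ = -4 := by
    linear_combination t₃ * h₁₁ + t₁ * h₂₂ + t₂ * h₃₃ + e2 + 2 * h
  have ec : t₁ ^ 3 + t₂ ^ 3 + t₃ ^ 3 = -4 := by
    linear_combination t₁ * h₁₁ + t₂ * h₂₂ + t₃ * h₃₃ + e2 + 2 * h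
  linear_combination S ^ 2 * (P + Q + R') * h + S * (P ^ 2 + Q ^ 2 + R' ^ 2) * e2 +
    S * (P * Q + Q * R' + R' * P) * ((t₁ + t₂ + t₃ - 1) * h - e2) +
    (P ^ 3 + Q ^ 3 + R' ^ 3) * e3 + (P ^ 2 * Q + Q ^ 2 * R' + R' ^ 2 * P) * ea +
    (P ^ 2 * R' + Q ^ 2 * P + R' ^ 2 * Q) * eb + P * Q * R' * (ec + 3 * e3)

/-- Multiplying the factors for $\zeta^i$ and $\zeta^{7-i}$ leaves only the periods, which reduces
the norm to a cubic one. -/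
theorem prod_seventh_roots {ζ : R} (h : ∑ i ∈ Finset.range 7, ζ ^ i = 0) (a b c d : R) :
    ∏ i ∈ Finset.range 7, (a + ζ ^ i * b + (ζ ^ i) ^ 2 * c + (ζ ^ i) ^ 5 * d) =
      (a + b + c + d) *
      ((a ^ 2 + b ^ 2 + c ^ 2 + d ^ 2 + (ζ + ζ ^ 6) * (a * b + b * c) +
        (ζ ^ 2 + ζ ^ 5) * (a * c + a * d) + (ζ ^ 3 + ζ ^ 4) * (b * d + c * d)) *
      (a ^ 2 + b ^ 2 + c ^ 2 + d ^ 2 + (ζ ^ 2 + ζ ^ 5) * (a * b + b * c) +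
        (ζ ^ 3 + ζ ^ 4) * (a * c + a * d) + (ζ + ζ ^ 6) * (b * d + c * d)) *
      (a ^ 2 + b ^ 2 + c ^ 2 + d ^ 2 + (ζ ^ 3 + ζ ^ 4) * (a * b + b * c) +
        (ζ + ζ ^ 6) * (a * c + a * d) + (ζ ^ 2 + ζ ^ 5) * (b * d + c * d))) := by
  have h7 : ζ ^ 7 = 1 := by
    simp only [Finset.sum_range_succ, Finset.sum_range_zero] at h
    linear_combination (ζ - 1) * h
  have pair (u v : R) (huv : u * v = 1) (hu : u ^ 7 = 1) (hv : v ^ 7 = 1) :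
      (a + u * b + u ^ 2 * c + u ^ 5 * d) * (a + v * b + v ^ 2 * c + v ^ 5 * d) =
      a ^ 2 + b ^ 2 + c ^ 2 + d ^ 2 + (u + v) * (a * b + b * c) +
        (u ^ 2 + v ^ 2) * (a * c + a * d) + (u ^ 3 + v ^ 3) * (b * d + c * d) := by
    have h2 : u ^ 2 * v ^ 2 = 1 := by rw [← mul_pow, huv, one_pow]
    have u5 : u ^ 5 = v ^ 2 := by linear_combination -u ^ 5 * h2 + v ^ 2 * hu
    have v5 : v ^ 5 = u ^ 2 := by linear_combination -v ^ 5 * h2 + u ^ 2 * hv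
    have h3 : u ^ 3 * v ^ 3 = 1 := by rw [← mul_pow, huv, one_pow]
    have u4 : u ^ 4 = v ^ 3 := by linear_combination -u ^ 4 * h3 + v ^ 3 * hu
    have v4 : v ^ 4 = u ^ 3 := by linear_combination -v ^ 4 * h3 + u ^ 3 * hv
    rw [u5, v5]
    linear_combination (b ^ 2 + b * c * (u + v)) * huv + (c ^ 2 + d ^ 2) * h2 +
      c * d * (u4 + v4)
  have hinv (i j : ℕ) (hij : i + j = 7) : ζ ^ i * ζ ^ j = 1 := by rw [← pow_add, hij, h7]
  have hone (i : ℕ) : (ζ ^ i) ^ 7 = 1 := by rw [← pow_mul, mul_comm, pow_mul, h7, one_pow]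
  have p1 := pair (ζ ^ 1) (ζ ^ 6) (hinv 1 6 rfl) (hone 1) (hone 6)
  have p2 := pair (ζ ^ 2) (ζ ^ 5) (hinv 2 5 rfl) (hone 2) (hone 5)
  have p3 := pair (ζ ^ 3) (ζ ^ 4) (hinv 3 4 rfl) (hone 3) (hone 4)
  have q1 : (ζ ^ 1) ^ 2 + (ζ ^ 6) ^ 2 = ζ ^ 2 + ζ ^ 5 := by linear_combination ζ ^ 5 * h7
  have q1' : (ζ ^ 1) ^ 3 + (ζ ^ 6) ^ 3 = ζ ^ 3 + ζ ^ 4 := by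
    linear_combination (ζ ^ 11 + ζ ^ 4) * h7
  have q2 : (ζ ^ 2) ^ 2 + (ζ ^ 5) ^ 2 = ζ ^ 3 + ζ ^ 4 := by linear_combination ζ ^ 3 * h7
  have q2' : (ζ ^ 2) ^ 3 + (ζ ^ 5) ^ 3 = ζ + ζ ^ 6 := by
    linear_combination (ζ ^ 8 + ζ) * h7
  have q3 : (ζ ^ 3) ^ 2 + (ζ ^ 4) ^ 2 = ζ + ζ ^ 6 := by linear_combination ζ * h7
  have q3' : (ζ ^ 3) ^ 3 + (ζ ^ 4) ^ 3 = ζ ^ 2 + ζ ^ 5 := by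
    linear_combination (ζ ^ 5 + ζ ^ 2) * h7
  rw [q1, q1', pow_one] at p1
  rw [q2, q2'] at p2
  rw [q3, q3'] at p3
  rw [← p1, ← p2, ← p3]
  have g0 : a + b + c + d = a + ζ ^ 0 * b + (ζ ^ 0) ^ 2 * c + (ζ ^ 0) ^ 5 * d := by simp
  rw [g0]
  have hperm (g : ℕ → R) : ∏ i ∈ Finset.range 7, g i =
      g 0 * (g 1 * g 6 * (g 2 * g 5) * (g 3 * g 4)) := by
    simp only [Finset.prod_range_succ, Finset.prod_range_zero]
    ring
  exact (hperm fun i => a + ζ ^ i * b + (ζ ^ i) ^ 2 * c + (ζ ^ i) ^ 5 * d).trans (by rw [pow_one])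

theorem prod_seventh_roots_eq_cubic {ζ : R} (h : ∑ i ∈ Finset.range 7, ζ ^ i = 0) (a b c d : R) :
    ∏ i ∈ Finset.range 7, (a + ζ ^ i * b + (ζ ^ i) ^ 2 * c + (ζ ^ i) ^ 5 * d) =
      (a + b + c + d) * ((a ^ 2 + b ^ 2 + c ^ 2 + d ^ 2) ^ 3 -
        (a ^ 2 + b ^ 2 + c ^ 2 + d ^ 2) ^ 2 *
          ((a * b + b * c) + (a * c + a * d) + (b * d + c * d)) +
        (a ^ 2 + b ^ 2 + c ^ 2 + d ^ 2) * (-2 * ((a * b + b * c) ^ 2 + (a * c + a * d) ^ 2 +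
          (b * d + c * d) ^ 2) + 3 * ((a * b + b * c) * (a * c + a * d) +
          (a * c + a * d) * (b * d + c * d) + (b * d + c * d) * (a * b + b * c))) +
        (a * b + b * c) ^ 3 + (a * c + a * d) ^ 3 + (b * d + c * d) ^ 3 +
        3 * ((a * b + b * c) ^ 2 * (a * c + a * d) + (a * c + a * d) ^ 2 * (b * d + c * d) +
          (b * d + c * d) ^ 2 * (a * b + b * c)) -
        4 * ((a * b + b * c) ^ 2 * (b * d + c * d) + (a * c + a * d) ^ 2 * (a * b + b * c) +
          (b * d + c * d) ^ 2 * (a * c + a * d)) -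
        (a * b + b * c) * (a * c + a * d) * (b * d + c * d)) := by
  rw [prod_seventh_roots h]
  have h7 : ζ ^ 7 = 1 := by
    simp only [Finset.sum_range_succ, Finset.sum_range_zero] at h
    linear_combination (ζ - 1) * h
  simp only [Finset.sum_range_succ, Finset.sum_range_zero] at h
  rw [cubic_period_norm (by linear_combination h) (by linear_combination (ζ ^ 5 + 2) * h7)
    (by linear_combination (ζ ^ 3 + 2) * h7) (by linear_combination (ζ + 2) * h7)
    (by linear_combination (ζ + ζ ^ 4) * h7) (by linear_combination (ζ ^ 2 + ζ) * h7)
    (by linear_combination (ζ ^ 3 + ζ ^ 2) * h7)]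

/-- `∏ (1 - ζⁱ y) = 1 - y⁷` over the seventh roots of unity. -/
theorem prod_one_sub_seventh_roots {ζ : R} (h : ∑ i ∈ Finset.range 7, ζ ^ i = 0) (y : R) :
    ∏ i ∈ Finset.range 7, (1 - ζ ^ i * y) = 1 - y ^ 7 := by
  have h1 := prod_seventh_roots_eq_cubic h 1 (-y) 0 0
  refine (Finset.prod_congr rfl fun i _ => ?_).trans (h1.trans ?_)
  · ring
  · ring

/-- The norm of `A + x B - x² + x⁵ C` with respect to `x ↦ ζ x`. -/
theorem prod_seventh_roots_dissection {ζ : R} (h : ∑ i ∈ Finset.range 7, ζ ^ i = 0)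
    (A B C x q : R) (hq : x ^ 7 = q) :
    ∏ i ∈ Finset.range 7, (A + ζ ^ i * x * B - (ζ ^ i * x) ^ 2 + (ζ ^ i * x) ^ 5 * C) =
      A ^ 7 + q * B ^ 7 + 7 * q * A * B ^ 5 + 14 * q * A ^ 2 * B ^ 3 + 7 * q * A ^ 3 * B + 7 * q * A ^ 4 * B ^ 2 * C
      + 7 * q * A ^ 5 * C - q ^ 2 + 7 * q ^ 2 * B ^ 3 * C + 14 * q ^ 2 * A * B * C + 7 * q ^ 2 * A * B ^ 4 * C ^ 2
      + 7 * q ^ 2 * A ^ 2 * B ^ 2 * C ^ 2 + 14 * q ^ 2 * A ^ 3 * C ^ 2 + 14 * q ^ 3 * B ^ 2 * C ^ 3 + 7 * q ^ 3 * A * C ^ 3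
      + 7 * q ^ 3 * A ^ 2 * B * C ^ 4 + 7 * q ^ 4 * B * C ^ 5 + q ^ 5 * C ^ 7 := by
  have h1 := prod_seventh_roots_eq_cubic h A (x * B) (-x ^ 2) (x ^ 5 * C)
  rw [← hq]
  refine (Finset.prod_congr rfl fun i _ => ?_).trans (h1.trans ?_)
  · ring
  · ring

end Cyclotomic

/-! ### Algebraic identities modulo the two relations. -/

/-- The quotient `(q)_∞^4 / (q ^ 7)_∞^4` in terms of `J₁, J₂, J₃`. -/
theorem dissection_norm_eq_sq {K : Type*} [Field K] {A B C q : K} (hABC : A * B * C = -1)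
    (hq : q * C = A ^ 2 - A * B ^ 2) :
    A ^ 7 + q * B ^ 7 + 7 * q * A * B ^ 5 + 14 * q * A ^ 2 * B ^ 3 + 7 * q * A ^ 3 * B + 7 * q * A ^ 4 * B ^ 2 * C
      + 7 * q * A ^ 5 * C - q ^ 2 + 7 * q ^ 2 * B ^ 3 * C + 14 * q ^ 2 * A * B * C + 7 * q ^ 2 * A * B ^ 4 * C ^ 2
      + 7 * q ^ 2 * A ^ 2 * B ^ 2 * C ^ 2 + 14 * q ^ 2 * A ^ 3 * C ^ 2 + 14 * q ^ 3 * B ^ 2 * C ^ 3 + 7 * q ^ 3 * A * C ^ 3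
      + 7 * q ^ 3 * A ^ 2 * B * C ^ 4 + 7 * q ^ 4 * B * C ^ 5 + q ^ 5 * C ^ 7 =
    (A * B ^ 5 - 8 * A ^ 2 * B ^ 3 + 5 * A ^ 3 * B - A ^ 5 * C) ^ 2 := by
  have hA : A ≠ 0 := by rintro rfl; simp at hABC
  have hB : B ≠ 0 := by rintro rfl; simp at hABC
  -- The relations determine $q$ and $C$ from $A$ and $B$, which are nonzero, leaving an identity of
  -- rational functions in two variables.
  obtain rfl : q = A ^ 2 * B ^ 3 - A ^ 3 * B := by linear_combination -A * B * hq + q * hABC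
  obtain rfl : C = -1 / (A * B) := by field_simp; linear_combination hABC
  field_simp
  ring

theorem dissection_mul_H {K : Type*} [Field K] {A B C x : K} (hABC : A * B * C = -1)
    (hq : x ^ 7 * C = A ^ 2 - A * B ^ 2) :
    (A + x * B - x ^ 2 + x ^ 5 * C) *
    ((2 * A ^ 2 * B ^ 8 + 2 * A ^ 3 * B ^ 6 - A ^ 4 * B ^ 4 - 13 * A ^ 5 * B ^ 2 + 11 * A ^ 6) +
    x * (5 * A ^ 2 * B ^ 7 - 9 * A ^ 3 * B ^ 5 + 15 * A ^ 4 * B ^ 3 - 15 * A ^ 5 * B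
      - 3 * A ^ 7 * C) +
    x ^ 2 * (11 * A ^ 2 * B ^ 6 - 31 * A ^ 3 * B ^ 4 + 26 * A ^ 4 * B ^ 2 - 5 * A ^ 5
      + A ^ 8 * C ^ 2) +
    x ^ 3 * (A * B ^ 7 + 8 * A ^ 2 * B ^ 5 - 18 * A ^ 3 * B ^ 3 + 11 * A ^ 4 * B
      + 5 * A ^ 6 * C) +
    x ^ 4 * (3 * A * B ^ 6 + 3 * A ^ 2 * B ^ 4 - 12 * A ^ 3 * B ^ 2 + 12 * A ^ 4
      - A ^ 7 * C ^ 2) +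
    x ^ 5 * (7 * A * B ^ 5 - 7 * A ^ 2 * B ^ 3 - 14 * A ^ 3 * B - 7 * A ^ 5 * C) +
    x ^ 6 * (B ^ 6 + A * B ^ 4 + 17 * A ^ 2 * B ^ 2 - 10 * A ^ 3 + 2 * A ^ 6 * C ^ 2)) =
    (A * B ^ 5 - 8 * A ^ 2 * B ^ 3 + 5 * A ^ 3 * B - A ^ 5 * C) ^ 2 := by
  have hA : A ≠ 0 := by rintro rfl; simp at hABC
  have hB : B ≠ 0 := by rintro rfl; simp at hABC
  have h7 : x ^ 7 = A ^ 2 * B ^ 3 - A ^ 3 * B := by linear_combination -A * B * hq + x ^ 7 * hABC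
  obtain rfl : C = -1 / (A * B) := by field_simp; linear_combination hABC
  -- The product has degree at most $5+6=11$ in $x$, so these reductions suffice.
  have h8 : x ^ 8 = x * (A ^ 2 * B ^ 3 - A ^ 3 * B) := by rw [← h7]; ring
  have h9 : x ^ 9 = x ^ 2 * (A ^ 2 * B ^ 3 - A ^ 3 * B) := by rw [← h7]; ring
  have h10 : x ^ 10 = x ^ 3 * (A ^ 2 * B ^ 3 - A ^ 3 * B) := by rw [← h7]; ring
  have h11 : x ^ 11 = x ^ 4 * (A ^ 2 * B ^ 3 - A ^ 3 * B) := by rw [← h7]; ring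
  field_simp
  ring_nf
  rw [h7, h8, h9, h10, h11]
  ring

/-! ### The product of $(\zeta^iq)_\infty$ over the seventh roots of unity. -/

/-- The substitution `q ↦ ζ q` from integral to complex power series. -/
noncomputable def complexRescale (ζ : ℂ) : ℤ⟦X⟧ →+* ℂ⟦X⟧ :=
  (rescale ζ).comp (PowerSeries.map (Int.castRingHom ℂ))

theorem coeff_complexRescale (ζ : ℂ) (n : ℕ) (f : ℤ⟦X⟧) :
    coeff n (complexRescale ζ f) = ζ ^ n * ((coeff n f : ℤ) : ℂ) := by
  simp [complexRescale, coeff_rescale]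

theorem complexRescale_X (ζ : ℂ) : complexRescale ζ X = C ζ * X := by
  simp [complexRescale, rescale_X]

theorem complexRescale_injective {ζ : ℂ} (h : ζ ≠ 0) : Function.Injective (complexRescale ζ) := by
  intro f g hfg
  ext n
  have := congrArg (coeff n) hfg
  simpa [coeff_complexRescale, h] using this

theorem complexRescale_expand {ζ : ℂ} {m : ℕ} (hm : m ≠ 0) (h : ζ ^ m = 1) (f : ℤ⟦X⟧) :
    complexRescale ζ (expand m hm f) = complexRescale 1 (expand m hm f) := by
  ext n
  rw [coeff_complexRescale, coeff_complexRescale, coeff_expand]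
  split_ifs with hn
  · obtain ⟨k, rfl⟩ := hn
    rw [pow_mul, h, one_pow, one_pow]
  · simp

open scoped PowerSeries.WithPiTopology in
theorem continuous_complexRescale (ζ : ℂ) : Continuous (complexRescale ζ) := by
  refine continuous_of_continuous_coeff _ fun n => ?_
  simp only [coeff_complexRescale]
  exact continuous_const.mul
    ((continuous_of_discreteTopology (f := fun m : ℤ => (m : ℂ))).comp
      (WithPiTopology.continuous_coeff ℤ n))

theorem prod_one_sub_primitiveRoot {ζ : ℂ} (h : IsPrimitiveRoot ζ 7) (m : ℕ) :
    ∏ i ∈ Finset.range 7, (1 - C (ζ ^ i) ^ m * (X : ℂ⟦X⟧) ^ m) =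
      if 7 ∣ m then (1 - X ^ m) ^ 7 else 1 - X ^ (7 * m) := by
  split_ifs with hm
  · obtain ⟨k, rfl⟩ := hm
    rw [Finset.prod_congr rfl (g := fun _ => 1 - (X : ℂ⟦X⟧) ^ (7 * k)), Finset.prod_const,
      Finset.card_range]
    intro i _
    rw [← map_pow, ← pow_mul, mul_left_comm, pow_mul ζ, h.pow_eq_one, one_pow, map_one, one_mul]
  · have hcop : m.Coprime 7 :=
      ((Nat.Prime.coprime_iff_not_dvd (by norm_num)).mpr hm).symm
    have h2 := congrArg (C (R := ℂ)) ((h.pow_of_coprime m hcop).geom_sum_eq_zero (by norm_num))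
    rw [map_sum, map_zero] at h2
    simp only [map_pow] at h2
    rw [mul_comm 7, pow_mul, ← prod_one_sub_seventh_roots h2]
    refine Finset.prod_congr rfl fun i _ => ?_
    rw [map_pow, ← pow_mul, ← pow_mul, mul_comm i]

-- The $m$-th factors multiply to $1-q^{7m}$ if $7\nmid m$ and to $(1-q^m)^7$ otherwise. The extra
-- $(q^{49})_\infty$ supplies the missing $1-q^{7m}$ with $7\mid m$, giving
-- $(q^7)_\infty\cdot(q^7)_\infty^7$.
open scoped PowerSeries.WithPiTopology in
theorem prod_complexRescale_qInf_one {ζ : ℂ} (h : IsPrimitiveRoot ζ 7) :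
    (∏ i ∈ Finset.range 7, complexRescale (ζ ^ i) (qInf 1)) * complexRescale 1 (qInf 49) =
      complexRescale 1 (qInf 7) ^ 8 := by
  have hE (i : ℕ) (_ : i ∈ Finset.range 7) :=
    (hasProd_qInf one_ne_zero).map (complexRescale (ζ ^ i)) (continuous_complexRescale _)
  have h7 := (hasProd_qInf (show 7 ≠ 0 by norm_num)).map (complexRescale 1)
    (continuous_complexRescale 1)
  have h49 := (hasProd_qInf (show 49 ≠ 0 by norm_num)).map (complexRescale 1)
    (continuous_complexRescale 1)
  have hprod := hasProd_prod hE
  have hinj : Function.Injective fun k : ℕ => 7 * k + 6 := fun a b hab => by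
    simpa using hab
  -- Both products are padded with ones so as to be indexed by the same $k$ as $(q)_\infty$. Index
  -- $k$ carries exponent $k+1$, hence the embedding $k\mapsto 7k+6$.
  set g49 : ℕ → ℂ⟦X⟧ := fun k => if 7 ∣ k + 1 then 1 - X ^ (7 * (k + 1)) else 1
  set g7 : ℕ → ℂ⟦X⟧ := fun k => if 7 ∣ k + 1 then 1 - X ^ (k + 1) else 1
  have hg49 : HasProd g49 (complexRescale 1 (qInf 49)) := by
    rw [← hinj.hasProd_iff]
    · convert h49 using 1
      funext k
      simp [g49, complexRescale_X, show 7 * k + 6 + 1 = 7 * (k + 1) by ring, ← mul_assoc]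
    · intro k hk
      refine if_neg fun ⟨j, hj⟩ => hk ⟨j - 1, ?_⟩
      show 7 * (j - 1) + 6 = k
      omega
  have hg7 : HasProd g7 (complexRescale 1 (qInf 7)) := by
    rw [← hinj.hasProd_iff]
    · convert h7 using 1
      funext k
      simp [g7, complexRescale_X, show 7 * k + 6 + 1 = 7 * (k + 1) by ring]
    · intro k hk
      refine if_neg fun ⟨j, hj⟩ => hk ⟨j - 1, ?_⟩
      show 7 * (j - 1) + 6 = k
      omega
  have hl := hprod.mul hg49
  have hpow : HasProd (fun k => ∏ _i ∈ Finset.range 7, g7 k)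
      (∏ _i ∈ Finset.range 7, complexRescale 1 (qInf 7)) := hasProd_prod fun _ _ => hg7
  have hr := hpow.mul h7
  rw [Finset.prod_const, Finset.card_range, ← pow_succ] at hr
  refine hl.unique ?_
  convert hr using 1
  funext k
  have h1 := prod_one_sub_primitiveRoot h (k + 1)
  simp only [Function.comp_apply, map_sub, map_one, map_pow, complexRescale_X, one_mul, mul_pow]
    at h1 ⊢
  rw [h1, Finset.prod_const, Finset.card_range]
  simp only [g49, g7]
  split_ifs
  · rfl
  · simp

/-! ### Evaluating the norm and dissecting the partition series. -/

/-- The polynomial in `J₁, J₂, J₃` equal to `(q)_∞^4 / (q^7)_∞^4`. -/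
noncomputable def dissectionNorm : ℤ⟦X⟧ :=
  J₁ * J₂ ^ 5 - 8 * J₁ ^ 2 * J₂ ^ 3 + 5 * J₁ ^ 3 * J₂ - J₁ ^ 5 * J₃

theorem map_relations {S : Type*} [CommRing S] (φ : ℤ⟦X⟧ →+* S) :
    φ J₁ * φ J₂ * φ J₃ = -1 ∧ φ X * φ J₃ = φ J₁ ^ 2 - φ J₁ * φ J₂ ^ 2 := by
  constructor
  · rw [← map_mul, ← map_mul, J₁_mul_J₂_mul_J₃, map_neg, map_one]
  · rw [← map_mul, X_mul_J₃, map_sub, map_mul, map_pow, map_pow]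

theorem qInf_one_pow_eight : qInf 1 ^ 8 = qInf 7 ^ 8 * dissectionNorm ^ 2 := by
  obtain ⟨ζ, h⟩ : ∃ ζ : ℂ, IsPrimitiveRoot ζ 7 :=
    ⟨_, Complex.isPrimitiveRoot_exp 7 (by norm_num)⟩
  have h49 : expand 7 (by norm_num) (qInf 7) = qInf 49 := expand_qInf (by norm_num) (by norm_num)
  have h7 : expand 7 (by norm_num) (qInf 1) = qInf 7 := expand_qInf (by norm_num) (by norm_num)
  have hsum := congrArg (C (R := ℂ)) (h.geom_sum_eq_zero (by norm_num))
  rw [map_sum, map_zero] at hsum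
  simp only [map_pow] at hsum
  -- The map $f(q)\mapsto f(q^7)$ into complex series. Its image is fixed by $q\mapsto\zeta q$, so
  -- the conjugates of $(q)_\infty$ differ only in the powers of $x$.
  set ψ : ℤ⟦X⟧ →+* ℂ⟦X⟧ :=
    (complexRescale 1).comp (expand (R := ℤ) 7 (by norm_num)).toRingHom
  have hψa (f : ℤ⟦X⟧) : complexRescale 1 (expand 7 (by norm_num) f) = ψ f := rfl
  have hinj : Function.Injective ψ := by
    refine (complexRescale_injective one_ne_zero).comp fun f g hfg => ?_
    ext n
    have := congrArg (coeff (7 * n)) hfg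
    simpa [coeff_expand] using this
  have hX : (X : ℂ⟦X⟧) ^ 7 = ψ X := by
    rw [← hψa, expand_X, map_pow, complexRescale_X, map_one, one_mul]
  obtain ⟨r1, r2⟩ := map_relations ((algebraMap ℂ⟦X⟧ (FractionRing ℂ⟦X⟧)).comp ψ)
  have hnorm := prod_seventh_roots_dissection hsum (ψ J₁) (ψ J₂) (ψ J₃) X _ hX
  have hW := dissection_norm_eq_sq r1 r2
  simp only [RingHom.comp_apply] at hW
  have hW' : _ = ψ dissectionNorm ^ 2 := hnorm.trans (by
    apply IsFractionRing.injective ℂ⟦X⟧ (FractionRing ℂ⟦X⟧)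
    simp only [dissectionNorm, map_add, map_sub, map_mul, map_pow, map_ofNat] at hW ⊢
    exact hW)
  have hE := prod_complexRescale_qInf_one h
  have hterm (i : ℕ) : complexRescale (ζ ^ i) (qInf 1) = ψ (qInf 7) *
      (ψ J₁ + C ζ ^ i * X * ψ J₂ - (C ζ ^ i * X) ^ 2 + (C ζ ^ i * X) ^ 5 * ψ J₃) := by
    have hi : (ζ ^ i) ^ 7 = 1 := by rw [← pow_mul, mul_comm, pow_mul, h.pow_eq_one, one_pow]
    rw [qInf_one_eq_qInf_mul_dissection, ← h49]
    simp only [map_mul, map_add, map_sub, map_pow, complexRescale_expand _ hi, hψa,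
      complexRescale_X]
  rw [Finset.prod_congr rfl fun i _ => hterm i, Finset.prod_mul_distrib, hW', Finset.prod_const,
    Finset.card_range, ← h49, ← h7, hψa, hψa, h7] at hE
  apply hinj
  rw [map_mul, map_pow, map_pow, map_pow]
  linear_combination -hE

theorem constantCoeff_dissection (r : ℕ) :
    constantCoeff (dissection r) = coeff r (qInf 1) := by
  have h := congrArg constantCoeff (qInf_seven_mul_dissection r)
  rw [map_mul, constantCoeff_qInf (by norm_num), one_mul] at h
  rw [h, ← coeff_zero_eq_constantCoeff_apply, coeff_residuePart, mul_zero, zero_add]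

theorem constantCoeff_dissectionNorm : constantCoeff dissectionNorm = 1 := by
  have h0 : coeff 0 (qInf 1) = 1 := coeff_qInf_one_pentagonal 0
  have h1 : coeff 1 (qInf 1) = -1 := by
    exact coeff_qInf_one_pentagonal 1
  have h5 : coeff 5 (qInf 1) = 1 := by
    exact coeff_qInf_one_pentagonal 2
  simp only [dissectionNorm, J₁, J₂, J₃, map_sub, map_add, map_mul, map_pow, map_ofNat,
    constantCoeff_dissection, h0, h1, h5]
  norm_num

theorem qInf_one_pow_four : qInf 1 ^ 4 = qInf 7 ^ 4 * dissectionNorm := by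
  have h : (qInf 1 ^ 4) ^ 2 = (qInf 7 ^ 4 * dissectionNorm) ^ 2 := by
    linear_combination qInf_one_pow_eight
  refine (sq_eq_sq_iff_eq_or_eq_neg.mp h).resolve_right fun h => ?_
  have := congrArg constantCoeff h
  simp [constantCoeff_dissectionNorm, constantCoeff_qInf] at this

theorem H_five : H 5 = 7 * (qInf 1 ^ 4 * qInfInv 7 4) + 49 * X := by
  have h1 := qInf_pow_mul_qInfInv (show 7 ≠ 0 by norm_num) 4
  have h2 : qInf 1 ^ 4 * qInfInv 7 4 = dissectionNorm := by
    rw [qInf_one_pow_four, mul_right_comm, h1, one_mul]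
  rw [h2, X_eq_J₁_J₂, dissectionNorm]
  simp [H]
  ring

theorem expand_dissection_mul_H : (expand 7 (by norm_num) J₁ + X * expand 7 (by norm_num) J₂ - X ^ 2
        + X ^ 5 * expand 7 (by norm_num) J₃) *
      (∑ a : Fin 7, X ^ (a : ℕ) * expand 7 (by norm_num) (H a)) =
    expand 7 (by norm_num) (dissectionNorm ^ 2) := by
  obtain ⟨r1, r2⟩ := map_relations
    ((algebraMap ℤ⟦X⟧ (FractionRing ℤ⟦X⟧)).comp (expand (R := ℤ) 7 (by norm_num)).toRingHom)
  have hX : expand 7 (by norm_num) (X : ℤ⟦X⟧) = X ^ 7 := expand_X 7 (by norm_num)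
  simp only [RingHom.comp_apply, AlgHom.toRingHom_eq_coe, RingHom.coe_coe, hX, map_pow] at r1 r2
  have h := dissection_mul_H r1 r2
  apply IsFractionRing.injective ℤ⟦X⟧ (FractionRing ℤ⟦X⟧)
  rw [Fin.sum_univ_seven]
  simp only [H, dissectionNorm, Matrix.cons_val, Fin.isValue, Fin.coe_ofNat_eq_mod, map_mul,
    map_add, map_sub, map_pow, map_ofNat]
  norm_num only
  linear_combination h

theorem residuePart_mk_partitionNumber (a : Fin 7) :
    PowerSeries.mk (fun k => (partitionNumber (7 * k + a) : ℤ)) =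
        qInf 7 ^ 7 * qInfInv 1 8 * H a := by
  have h49 : expand 7 (by norm_num) (qInf 7) = qInf 49 := expand_qInf (by norm_num) (by norm_num)
  have h7 : expand 7 (by norm_num) (qInf 1) = qInf 7 := expand_qInf (by norm_num) (by norm_num)
  set F : ℤ⟦X⟧ := ∑ r ∈ Finset.range 7, X ^ r * expand 7 (by norm_num)
    (qInf 7 ^ 7 * qInfInv 1 8 * H (Fin.ofNat 7 r)) with hF
  -- The candidate assembled from the claimed components inverts $(q)_\infty$, so it is the
  -- partition series; its components are then read off by uniqueness.
  have h1 : qInf 1 * F = 1 := by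
    have h2 : F = expand 7 (by norm_num) (qInf 7 ^ 7 * qInfInv 1 8) *
        ∑ a : Fin 7, X ^ (a : ℕ) * expand 7 (by norm_num) (H a) := by
      rw [hF, Finset.mul_sum, Finset.sum_range]
      refine Finset.sum_congr rfl fun a _ => ?_
      rw [map_mul, Fin.ofNat_val_eq_self]
      ring
    have h3 := qInf_pow_mul_qInfInv one_ne_zero 8
    calc qInf 1 * F = qInf 49 * expand 7 (by norm_num) (qInf 7 ^ 7 * qInfInv 1 8) *
          ((expand 7 (by norm_num) J₁ + X * expand 7 (by norm_num) J₂ - X ^ 2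
          + X ^ 5 * expand 7 (by norm_num) J₃) *
          (∑ a : Fin 7, X ^ (a : ℕ) * expand 7 (by norm_num) (H a))) := by
            rw [h2, qInf_one_eq_qInf_mul_dissection]; ring
      _ = expand 7 (by norm_num) (qInf 7 ^ 8 * dissectionNorm ^ 2 * qInfInv 1 8) := by
            rw [expand_dissection_mul_H, ← h49, ← map_mul, ← map_mul]; congr 1; ring
      _ = 1 := by rw [← qInf_one_pow_eight, h3, map_one]
  have h4 : PowerSeries.mk (fun n => (partitionNumber n : ℤ)) = F :=
    mul_left_cancel₀ (qInf_ne_zero one_ne_zero) (qInf_one_mul_mk_partitionNumber.trans h1.symm)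
  have h5 := congrArg (residuePart a) h4
  rw [hF, residuePart_sum a.isLt, Fin.ofNat_val_eq_self] at h5
  rw [← h5]
  ext n
  rw [coeff_residuePart, coeff_mk, coeff_mk]

/-! ### Determinant formula. -/

/-- Cramer's rule for the quotient of two power series. -/
theorem coeff_eq_det_toeplitzLastCol {D P Z : ℤ⟦X⟧} (hD : constantCoeff D = 1) (h : D * P = Z)
    (k : ℕ) : coeff k P = (toeplitzLastCol D Z k).det := by
  let L : Matrix (Fin (k + 1)) (Fin (k + 1)) ℤ :=
    Matrix.of fun i j => if j ≤ i then coeff ((i : ℕ) - (j : ℕ)) D else 0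
  let p : Fin (k + 1) → ℤ := fun j => coeff j P
  let z : Fin (k + 1) → ℤ := fun i => coeff i Z
  have hdet : L.det = 1 := by
    rw [Matrix.det_of_isLowerTriangular L fun i j hij => if_neg (not_le.mpr hij)]
    exact Finset.prod_eq_one fun i _ => by simp [L, hD]
  -- The first $k+1$ coefficients of $DP=Z$ form a unitriangular system; Cramer's rule for its last
  -- unknown replaces the last column by $Z$.
  have hz : L.mulVec p = z := by
    funext i
    simp only [Matrix.mulVec, dotProduct, L, p, z, Matrix.of_apply, ← h]
    rw [mul_comm D, coeff_mul, Finset.Nat.sum_antidiagonal_eq_sum_range_succ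
      (fun a b => coeff a P * coeff b D), Finset.sum_congr rfl (g := fun j : Fin (k + 1) =>
        (fun m : ℕ => if m ≤ i then coeff m P * coeff ((i : ℕ) - m) D else 0) j),
      Fin.sum_univ_eq_sum_range
        (fun m : ℕ => if m ≤ i then coeff m P * coeff ((i : ℕ) - m) D else 0),
      ← Finset.sum_filter]
    · refine Finset.sum_congr ?_ fun _ _ => rfl
      ext m
      simp only [Finset.mem_filter, Finset.mem_range]
      omega
    · intro j _
      simp only [Fin.le_def, ite_mul, zero_mul]
      split_ifs
      · ring
      · rfl
  have hT : toeplitzLastCol D Z k = L.updateCol (Fin.last k) z := by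
    ext i j
    rw [Matrix.updateCol_apply]
    rfl
  rw [hT, ← Matrix.cramer_apply, Matrix.cramer_eq_adjugate_mulVec, ← hz, Matrix.mulVec_mulVec,
    Matrix.adjugate_mul, hdet, one_smul, Matrix.one_mulVec]
  simp [p]

/-! ### First eight coefficients, computed modulo $q^8$ by repeated squaring. -/

theorem X_pow_dvd_sq_sub {n : ℕ} {f g h : ℤ⟦X⟧} (hf : X ^ n ∣ f - g) (hg : X ^ n ∣ g ^ 2 - h) :
    X ^ n ∣ f ^ 2 - h := by
  rw [show f ^ 2 - h = (f - g) * (f + g) + (g ^ 2 - h) by ring]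
  exact dvd_add (hf.mul_right _) hg

theorem X_pow_eight_dvd_qInf_one_sub :
    (X : ℤ⟦X⟧) ^ 8 ∣ qInf 1 - (1 - X - X ^ 2 + X ^ 5 + X ^ 7) := by
  have h1 := X_pow_dvd_qInf_one_sub_qPoch 7
  have h2 : (X : ℤ⟦X⟧) ^ 8 ∣ qPoch X 7 - (1 - X - X ^ 2 + X ^ 5 + X ^ 7) := by
    -- The witness is the tail of $(q)_7$ from $q^8$ on, divided by $q^8$; the witnesses for the
    -- squarings below are tails likewise.
    refine ⟨1 - X ^ 2 - X ^ 3 - 2 * X ^ 4 + 2 * X ^ 8 + X ^ 9 + X ^ 10 - X ^ 12 - X ^ 13 - X ^ 15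
      + X ^ 18 + X ^ 19 - X ^ 20, ?_⟩
    simp only [qPoch, Finset.prod_range_succ, Finset.prod_range_zero]
    ring
  simpa using dvd_add h1 h2

theorem X_pow_eight_dvd_qInf_one_pow_four_sub : (X : ℤ⟦X⟧) ^ 8 ∣ qInf 1 ^ 4 -
    (1 - 4 * X + 2 * X ^ 2 + 8 * X ^ 3 - 5 * X ^ 4 - 4 * X ^ 5 - 10 * X ^ 6 + 8 * X ^ 7) := by
  have h2 : (X : ℤ⟦X⟧) ^ 8 ∣ qInf 1 ^ 2 -
      (1 - 2 * X - X ^ 2 + 2 * X ^ 3 + X ^ 4 + 2 * X ^ 5 - 2 * X ^ 6) :=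
    X_pow_dvd_sq_sub X_pow_eight_dvd_qInf_one_sub
      ⟨-2 - 2 * X + X ^ 2 + 2 * X ^ 4 + X ^ 6, by ring⟩
  rw [show qInf 1 ^ 4 = (qInf 1 ^ 2) ^ 2 by ring]
  exact X_pow_dvd_sq_sub h2 ⟨13 - 4 * X - 8 * X ^ 3 + 4 * X ^ 4, by ring⟩

theorem X_pow_eight_dvd_qInf_one_pow_eight_sub : (X : ℤ⟦X⟧) ^ 8 ∣ qInf 1 ^ 8 -
    (1 - 8 * X + 20 * X ^ 2 - 70 * X ^ 4 + 64 * X ^ 5 + 56 * X ^ 6) := by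
  rw [show qInf 1 ^ 8 = (qInf 1 ^ 4) ^ 2 by ring]
  exact X_pow_dvd_sq_sub X_pow_eight_dvd_qInf_one_pow_four_sub
    ⟨-143 - 88 * X + 244 * X ^ 2 + 36 * X ^ 4 - 160 * X ^ 5 + 64 * X ^ 6, by ring⟩

theorem X_pow_eight_dvd_numerator_sub :
    (X : ℤ⟦X⟧) ^ 8 ∣ (7 * qInf 7 ^ 3 * qInf 1 ^ 4 + 49 * X * qInf 7 ^ 7) -
      (7 + 21 * X + 14 * X ^ 2 + 56 * X ^ 3 - 35 * X ^ 4 - 28 * X ^ 5 - 70 * X ^ 6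
        + 35 * X ^ 7) := by
  have h1 : (X : ℤ⟦X⟧) ^ 14 ∣ qInf 7 - (1 - X ^ 7) := by
    have h1 := map_dvd (expand (R := ℤ) 7 (by norm_num)) (X_pow_dvd_qInf_one_sub_qPoch 1)
    rw [map_sub, expand_qInf (by norm_num) (by norm_num)] at h1
    simpa only [qPoch, Finset.prod_range_one, map_sub, map_one, map_pow, expand_X, zero_add,
      pow_one, Nat.reduceMul, Nat.reduceAdd, mul_one, ← pow_mul] using h1
  -- Precision $q^7$ is enough here because this term carries the factor $49q$.
  have h2 : (X : ℤ⟦X⟧) ^ 7 ∣ qInf 7 ^ 7 - 1 ^ 7 := by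
    refine dvd_trans ?_ (sub_dvd_pow_sub_pow (qInf 7) 1 7)
    have h3 := dvd_sub ((pow_dvd_pow X (by norm_num)).trans h1) (dvd_refl ((X : ℤ⟦X⟧) ^ 7))
    rwa [show qInf 7 - (1 - X ^ 7) - X ^ 7 = qInf 7 - 1 by ring] at h3
  obtain ⟨r, hr⟩ := X_pow_eight_dvd_qInf_one_pow_four_sub
  obtain ⟨s, hs⟩ := h1.trans (sub_dvd_pow_sub_pow (qInf 7) (1 - X ^ 7) 3)
  obtain ⟨t, ht⟩ := h2
  refine ⟨7 * X ^ 6 * s * qInf 1 ^ 4 + 7 * (1 - X ^ 7) ^ 3 * r + 49 * t +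
    7 * (3 * X ^ 6 - X ^ 13) * (1 - 4 * X + 2 * X ^ 2 + 8 * X ^ 3 - 5 * X ^ 4 - 4 * X ^ 5
      - 10 * X ^ 6 + 8 * X ^ 7) -
    21 * (-4 + 2 * X + 8 * X ^ 2 - 5 * X ^ 3 - 4 * X ^ 4 - 10 * X ^ 5 + 8 * X ^ 6), ?_⟩
  linear_combination 7 * qInf 1 ^ 4 * hs + 7 * (1 - X ^ 7) ^ 3 * hr + 49 * X * ht

theorem map_coeff_range_eight {f g : ℤ⟦X⟧} (h : X ^ 8 ∣ f - g) :
    (List.range 8).map (fun j => coeff j f) = (List.range 8).map (fun j => coeff j g) := by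
  refine List.map_congr_left fun j hj => ?_
  have := X_pow_dvd_iff.mp h j (List.mem_range.mp hj)
  rwa [map_sub, sub_eq_zero] at this

theorem map_coeff_sum_fin_eight (c : Fin 8 → ℤ) :
    (List.range 8).map (fun j => coeff j (∑ i : Fin 8, C (c i) * X ^ (i : ℕ))) =
      List.ofFn c := by
  rw [← List.map_coe_finRange_eq_range, List.map_map, List.ofFn_eq_map]
  refine List.map_congr_left fun j _ => ?_
  simp only [Function.comp_apply, map_sum, coeff_C_mul, coeff_X_pow, Fin.val_inj, mul_ite, mul_one,
    mul_zero, Finset.sum_ite_eq, Finset.mem_univ, if_true]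

theorem map_coeff_qInf_one_pow_eight :
    (List.range 8).map (fun j => coeff j (qInf 1 ^ 8)) = [1, -8, 20, 0, -70, 64, 56, 0] := by
  rw [map_coeff_range_eight (g := ∑ i : Fin 8, C ((![1, -8, 20, 0, -70, 64, 56, 0] : Fin 8 → ℤ) i) * X ^ (i : ℕ)),
    map_coeff_sum_fin_eight]
  · rfl
  · convert X_pow_eight_dvd_qInf_one_pow_eight_sub using 2
    simp [Fin.sum_univ_eight]
    ring

theorem map_coeff_numerator :
    (List.range 8).map
      (fun j => coeff j (7 * qInf 7 ^ 3 * qInf 1 ^ 4 + 49 * X * qInf 7 ^ 7)) =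
        [7, 21, 14, 56, -35, -28, -70, 35] := by
  rw [map_coeff_range_eight (g := ∑ i : Fin 8, C ((![7, 21, 14, 56, -35, -28, -70, 35] : Fin 8 → ℤ) i) * X ^ (i : ℕ)),
    map_coeff_sum_fin_eight]
  · rfl
  · convert X_pow_eight_dvd_numerator_sub using 2
    simp [Fin.sum_univ_eight]
    ring

theorem mainTheorem1 :
    -- the 7-dissection of `(q^{1/7})_∞ / (q^7)_∞`, written in the variable `q^{1/7}`
    (qInf 1 * qInfInv 49 1 =
      expand 7 (by norm_num) J₁ + X * expand 7 (by norm_num) J₂ - X ^ 2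
        + X ^ 5 * expand 7 (by norm_num) J₃) ∧
    -- the generating functions
    (∀ a : Fin 7,
      PowerSeries.mk (fun k => (partitionNumber (7 * k + a) : ℤ)) =
        qInf 7 ^ 7 * qInfInv 1 8 * H a) ∧
    -- the determinant formulas
    (∀ (a : Fin 7) (k : ℕ),
      (partitionNumber (7 * k + a) : ℤ) =
        (toeplitzLastCol (qInf 1 ^ 8) (qInf 7 ^ 7 * H a) k).det) ∧
    -- the first entries of the Toeplitz columns
    (List.range 8).map (fun j => coeff j (qInf 1 ^ 8)) = [1, -8, 20, 0, -70, 64, 56, 0] ∧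
    -- the case `a = 5`
    H 5 = 7 * (qInf 1 ^ 4 * qInfInv 7 4) + 49 * X ∧
    PowerSeries.mk (fun k => (partitionNumber (7 * k + 5) : ℤ)) =
      qInf 7 ^ 7 * qInfInv 1 8 * (7 * (qInf 1 ^ 4 * qInfInv 7 4) + 49 * X) ∧
    (∀ k : ℕ,
      (partitionNumber (7 * k + 5) : ℤ) =
        (toeplitzLastCol (qInf 1 ^ 8)
          (7 * qInf 7 ^ 3 * qInf 1 ^ 4 + 49 * X * qInf 7 ^ 7) k).det) ∧
    (List.range 8).map
      (fun j => coeff j (7 * qInf 7 ^ 3 * qInf 1 ^ 4 + 49 * X * qInf 7 ^ 7)) =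
        [7, 21, 14, 56, -35, -28, -70, 35] := by
  have hgen : PowerSeries.mk (fun k => (partitionNumber (7 * k + 5) : ℤ)) =
      qInf 7 ^ 7 * qInfInv 1 8 * H 5 := residuePart_mk_partitionNumber 5
  have h8 := qInf_pow_mul_qInfInv one_ne_zero 8
  have h4 := qInf_pow_mul_qInfInv (show 7 ≠ 0 by norm_num) 4
  have hdet (a : Fin 7) (k : ℕ) : (partitionNumber (7 * k + a) : ℤ) =
      (toeplitzLastCol (qInf 1 ^ 8) (qInf 7 ^ 7 * H a) k).det := by
    rw [← coeff_eq_det_toeplitzLastCol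
      (P := PowerSeries.mk (fun k => (partitionNumber (7 * k + a) : ℤ))), coeff_mk]
    · rw [map_pow, constantCoeff_qInf one_ne_zero, one_pow]
    · rw [residuePart_mk_partitionNumber]
      linear_combination qInf 7 ^ 7 * H a * h8
  have hZ : 7 * qInf 7 ^ 3 * qInf 1 ^ 4 + 49 * X * qInf 7 ^ 7 = qInf 7 ^ 7 * H 5 := by
    rw [H_five]
    linear_combination -7 * qInf 7 ^ 3 * qInf 1 ^ 4 * h4
  refine ⟨qInf_one_mul_qInfInv, residuePart_mk_partitionNumber, hdet,
    map_coeff_qInf_one_pow_eight, H_five, H_five ▸ hgen, fun k => ?_, map_coeff_numerator⟩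
  rw [hZ]
  exact hdet 5 k
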